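/- For $z\in\mathbb{C}$ and $0<p<1$ put $(z;p)_n=\prod_{j=0}^{n-1}(1-zp^j)$, $(z;p)_\infty=\prod_{j\ge 0}(1-zp^j)$, and $(z_1,\dots,z_k;p)_n=(z_1;p)_n\cdots(z_k;p)_n$ for $n\in\mathbb{N}_0\cup\{\infty\}$. Let $q\in(0,1)$ and let $a\in\mathbb{R}\setminus\{0\}$ with $|a|<q^{-1/4}$ (in particular, $a=q^{\alpha/2+1/4}$ with $\alpha>-1$ is allowed). For real $c\neq 0$ and $d$ with $cd<1$, let $Q_n(x;c,d\,|\,q)$ be the Al-Salam--Chihara polynomials: $Q_{-1}=0$, $Q_0=1$ and $Q_{n+1}=(2x-(c+d)q^n)Q_n-(1-q^n)(1-cdq^{n-1})Q_{n-1}$; put $$\phi_n(2x;c,d)=\frac{Q_n(x;c,d\,|\,q)}{\sqrt{(q,cd;q)_n}},\qquad n\in\mathbb{N}_0.$$ For $(c,d)=(a,aq^{1/2})$ write $\phi_n(2x)=\phi_n(2x;a,aq^{1/2})$; with $a=q^{\alpha/2+1/4}$ these are the normalized continuous $q$-Laguerre polynomials. Consider, for $m,n\in\mathbb{N}_0$,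 the matrices $$G_{m,n}(a;q)=\frac{q^{(m-n)^2/4}(aq^{1/4};q^{1/2})_{m+n}}{\sqrt{(q,a^2q^{1/2};q)_m(q,a^2q^{1/2};q)_n}},$$ $$H_{m,n}(c,d)=\frac{(-c)^{m+n}q^{m(m-1)/2+n(n-1)/2}}{\sqrt{(q,cd;q)_m(q,cd;q)_n}}\sum_{k=0}^\infty\frac{q^{k(k-1)}}{(qd/c,q;q)_k}\Bigl(\frac{q^{2-m-n}}{c^2}\Bigr)^{k},$$ the latter for $(c,d)=(a,aq^{1/2})$ and $(c,d)=(aq^{1/2},a)$, and define the functions $$g(x)=\sum_{n=0}^\infty G_{0,n}(a;q)\,\phi_n(2x),\qquad h(x;c,d)=\sum_{n=0}^\infty H_{0,n}(c,d)\,\phi_n(2x;c,d).$$ Then for every $\theta\in(0,\pi)$ the series defining $g(\cos\theta)$ converges absolutely, and $$g(\cos\theta)=\frac{(q^{1/2};q)_\infty\,(-q^{1/4}e^{i\theta},-q^{1/4}e^{-i\theta};q^{1/2})_\infty}{(-aq^{1/4};q^{1/2})_\infty}.$$ Moreover, $g$ is the spectral function of $G(a;q)$ with respect to $(\phi_n)$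 in the sense that $$\sum_{n=0}^\infty G_{m,n}(a;q)\,\phi_n(2\cos\theta)=g(\cos\theta)\,\phi_m(2\cos\theta)\qquad\text{for all } m\in\mathbb{N}_0,$$ with absolute convergence. If, in addition, $a\neq q^{1/4+k/2}$ for all $k\in\mathbb{N}_0$, then the series defining $h(\cos\theta;a,aq^{1/2})$ and $h(\cos\theta;aq^{1/2},a)$ converge absolutely, and $$g(\cos\theta)=A\,h(\cos\theta;a,aq^{1/2})+B\,h(\cos\theta;aq^{1/2},a),$$ where $$A=-\frac{q^{1/4}}{a(1-q^{1/2})(q^{1/4}/a;q^{1/2})_\infty},\qquad B=\frac{1}{(q^{1/4}/a;q^{1/2})_\infty}.$$ -/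

import Mathlib

noncomputable section

namespace QHankel

/-- The finite `q`-Pochhammer symbol `(a; q)_n = ∏_{j < n} (1 - a q ^ j)`. -/
def qPoch (a q : ℝ) (n : ℕ) : ℝ := ∏ j ∈ Finset.range n, (1 - a * q ^ j)

/-- The infinite `q`-Pochhammer symbol `(z; q)_∞ = ∏_{j ≥ 0} (1 - z q ^ j)`, with a complex
first argument; the product converges for `|q| < 1`. -/
def qPochInf (z : ℂ) (q : ℝ) : ℂ := ∏' j : ℕ, (1 - z * (q : ℂ) ^ j)

/-- The infinite `q`-Pochhammer symbol with a real first argument. -/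
def qPochInfReal (a q : ℝ) : ℝ := ∏' j : ℕ, (1 - a * q ^ j)

/-- The basic hypergeometric series
`₀φ₁(-; b; q, z) = ∑_k q ^ (k (k - 1)) z ^ k / ((b; q)_k (q; q)_k)`. -/
def zeroPhiOne (b q z : ℝ) : ℝ :=
  ∑' k : ℕ, q ^ (k * (k - 1)) * z ^ k / (qPoch b q k * qPoch q q k)

/-- The Al-Salam--Chihara polynomials `Q_n(x; a, b | q)`, by their three-term recurrence. -/
def alSalamChihara (a b q x : ℝ) : ℕ → ℝ
  | 0 => 1
  | 1 => 2 * x - (a + b)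
  | n + 2 => (2 * x - (a + b) * q ^ (n + 1)) * alSalamChihara a b q x (n + 1)
      - (1 - q ^ (n + 1)) * (1 - a * b * q ^ n) * alSalamChihara a b q x n

/-- The normalizing factor `√((q, ab; q)_n)`. -/
def normFactor (a b q : ℝ) (n : ℕ) : ℝ := Real.sqrt (qPoch q q n * qPoch (a * b) q n)

/-- The orthonormal Al-Salam--Chihara polynomials `φ_n`, in the scaling in which
`φ_n(2x) = Q_n(x; a, b | q) / √((q, ab; q)_n)`. For `b = a q ^ (1/2)`, where
`a = q ^ (α/2 + 1/4)`, these are the orthonormal continuous `q`-Laguerre polynomials. -/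
def phi (a b q : ℝ) (n : ℕ) (y : ℝ) : ℝ :=
  alSalamChihara a b q (y / 2) n / normFactor a b q n

/-- The weight `w_n(a, b) = (-a) ^ n q ^ (n (n - 1) / 2) / √((q, ab; q)_n)`. -/
def weight (a b q : ℝ) (n : ℕ) : ℝ :=
  (-a) ^ n * q ^ (n * (n - 1) / 2) / normFactor a b q n

/-- The Hankel part `h_n(a, b) = ₀φ₁(-; qb/a; q, q ^ (2 - n) / a ^ 2)`. -/
def hankelPart (a b q : ℝ) (n : ℕ) : ℝ :=
  zeroPhiOne (q * b / a) q (q ^ (2 - (n : ℤ)) / a ^ 2)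

/-- The weighted Hankel matrix `H(a, b)`, with entries `w_m h_{m+n} w_n`. -/
def matH (a b q : ℝ) (m n : ℕ) : ℝ :=
  weight a b q m * hankelPart a b q (m + n) * weight a b q n

/-- The weighted Hankel matrix `G(a; q)`, with entries
`q ^ ((m - n)² / 4) (a q^{1/4}; q^{1/2})_{m+n} /
  √((q, a² q^{1/2}; q)_m (q, a² q^{1/2}; q)_n)`. -/
def matG (a q : ℝ) (m n : ℕ) : ℝ :=
  q ^ (((m : ℝ) - (n : ℝ)) ^ 2 / 4) * qPoch (a * q ^ (1 / 4 : ℝ)) (q ^ (1 / 2 : ℝ)) (m + n) /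
    Real.sqrt ((qPoch q q m * qPoch (a ^ 2 * q ^ (1 / 2 : ℝ)) q m) *
      (qPoch q q n * qPoch (a ^ 2 * q ^ (1 / 2 : ℝ)) q n))

/-- The function `h(x; a, b) = ∑_n H_{0,n}(a, b) φ_n(2x)`. -/
def funH (a b q x : ℝ) : ℝ := ∑' n : ℕ, matH a b q 0 n * phi a b q n (2 * x)

/-- The function `g(x) = ∑_n G_{0,n}(a; q) φ_n(2x)`, with the orthonormal continuous
`q`-Laguerre polynomials `φ_n`. -/
def funG (a q x : ℝ) : ℝ :=
  ∑' n : ℕ, matG a q 0 n * phi a (a * q ^ (1 / 2 : ℝ)) q n (2 * x)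

/-- `A = - q^{1/4} / (a (1 - q^{1/2}) (q^{1/4}/a; q^{1/2})_∞)`. -/
def coeffA (a q : ℝ) : ℝ :=
  -(q ^ (1 / 4 : ℝ) / (a * (1 - q ^ (1 / 2 : ℝ)) *
    qPochInfReal (q ^ (1 / 4 : ℝ) / a) (q ^ (1 / 2 : ℝ))))

/-- `B = 1 / (q^{1/4}/a; q^{1/2})_∞`. -/
def coeffB (a q : ℝ) : ℝ :=
  1 / qPochInfReal (q ^ (1 / 4 : ℝ) / a) (q ^ (1 / 2 : ℝ))

end QHankel

end

/-!
Write `p = q ^ (1/2)` and `s = q ^ (1/4)`, so that `q = s⁴`, and `Q_n` for the Al-Salam–Chihara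
polynomials with parameters `a, ap`. Since `(a²p; q)_n = (as; p)_n (-as; p)_n`, the series for `g`
is `∑ s ^ (n²) Q_n / ((q; q)_n (-as; p)_n)`, which also makes sense for complex `a`, `|as| < 1`.

*Evaluation of `g`.* The contiguous relation `asc_contiguous` turns the series for `a` into the one
for `ap`, up to the factor `1 + as` and a telescoping sum (`tsum_gTerm_shift`). Iterating and letting
`a p ^ k → 0`, the product of `(-as; p)_∞` with the series is independent of `a`
(`qPochInf_mul_tsum_gTerm`). It may therefore be computed at `a = e ^ (iθ)`, where `Q_n` is a product
(`asc_mul_pow`) and the series is the summable `₁φ₁(A; C; p, C/A)`, with `A = s e ^ (iθ)` and `C = -p`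
(`tsum_onePhiOneTerm`, again by a telescoping shift and a limit).

*Spectral equation.* `G` commutes with the Jacobi matrix of the polynomials (`jacobiEntry_comm`), so
`m ↦ ∑ G_{m,n} φ_n` satisfies their three-term recurrence and is the multiple of `φ_m` fixed by its
value at `m = 0` (`tsum_gEntry_eq`).

*The decomposition.* The identity `g = A h + B h` holds term by term: the two `₀φ₁` series are the even
and the odd part of Euler's series `∑ p ^ (k choose 2) (-y) ^ k / (p; p)_k = (y; p)_∞` at
`y = s p ^ (-n) / a`, and `(y; p)_∞ = (y; p)_n (s/a; p)_∞`, where `(y; p)_n` is the reversal of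
`(as; p)_n` (`hankelPart_sub`, `qProd_hankelArg`, `gEntry_zero_eq`). The value `(-|y|; p)_∞` bounds
both parts and gives the absolute convergence of the series for `h`.
-/

noncomputable section

namespace QHankel

open Filter Topology

/-! ### Finite `q`-products and Al-Salam–Chihara polynomials over a field -/

section Algebra

variable {K : Type*} [Field K]

/-- The finite `q`-product `(a; p)_n = ∏_{j < n} (1 - a p ^ j)` over a field. -/
def qProd (a p : K) (n : ℕ) : K := ∏ j ∈ Finset.range n, (1 - a * p ^ j)

@[simp] lemma qProd_zero (a p : K) : qProd a p 0 = 1 := by simp [qProd]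

lemma qProd_succ (a p : K) (n : ℕ) : qProd a p (n + 1) = qProd a p n * (1 - a * p ^ n) := by
  simp [qProd, Finset.prod_range_succ]

lemma qProd_succ' (a p : K) (n : ℕ) : qProd a p (n + 1) = (1 - a) * qProd (a * p) p n := by
  rw [qProd, Finset.prod_range_succ', qProd, mul_comm]
  simp only [pow_zero, mul_one, pow_succ']
  congr 1
  exact Finset.prod_congr rfl fun j _ => by ring

lemma qProd_zero_left (p : K) (n : ℕ) : qProd 0 p n = 1 := by simp [qProd]

lemma qProd_sq (a p : K) (n : ℕ) : qProd (a ^ 2) (p ^ 2) n = qProd a p n * qProd (-a) p n := by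
  rw [qProd, qProd, qProd, ← Finset.prod_mul_distrib]
  exact Finset.prod_congr rfl fun j _ => by ring

lemma qProd_two_mul (a p : K) (n : ℕ) :
    qProd a p (2 * n) = qProd a (p ^ 2) n * qProd (a * p) (p ^ 2) n := by
  induction n with
  | zero => simp
  | succ n ih =>
    rw [show 2 * (n + 1) = 2 * n + 1 + 1 by ring, qProd_succ, qProd_succ, ih, qProd_succ,
      qProd_succ]
    ring

/-- The Al-Salam–Chihara polynomials over an arbitrary field. -/
def asc (a b q x : K) : ℕ → K
  | 0 => 1
  | 1 => 2 * x - (a + b)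
  | n + 2 => (2 * x - (a + b) * q ^ (n + 1)) * asc a b q x (n + 1)
      - (1 - q ^ (n + 1)) * (1 - a * b * q ^ n) * asc a b q x n

lemma asc_comm (a b q x : K) (n : ℕ) : asc a b q x n = asc b a q x n := by
  induction n using Nat.twoStepInduction with
  | zero => rfl
  | one => simp only [asc]; ring
  | more n h1 h2 => simp only [asc, h1, h2]; ring

/-- The contiguous relation obtained by multiplying the first parameter by `q`. In terms of the
generating function `(at, bt; q)_∞ / (te^{iθ}, te^{-iθ}; q)_∞` it splits off the factor `1 - at`. -/
lemma asc_contiguous (a b q x : K) (n : ℕ) :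
    asc a b q x (n + 1) =
      asc (a * q) b q x (n + 1) - a * (1 - q ^ (n + 1)) * asc (a * q) b q x n := by
  induction n using Nat.twoStepInduction with
  | zero => simp only [asc]; ring
  | one => simp only [asc]; ring
  | more n h1 h2 =>
    rw [asc, h1, h2]
    simp only [asc]
    ring

/-- At `x = (z + z⁻¹) / 2` and with `z` as one of its parameters, the Al-Salam–Chihara polynomial
is a product. -/
lemma asc_mul_pow {z x : K} (hx : 2 * x * z = z ^ 2 + 1) (b q : K) (n : ℕ) :
    asc z b q x n * z ^ n = qProd (b * z) q n := by
  induction n using Nat.twoStepInduction with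
  | zero => simp [asc]
  | one => simp only [asc, qProd_succ, qProd_zero]; linear_combination hx
  | more n h1 h2 =>
    rw [qProd_succ] at h2
    rw [qProd_succ, qProd_succ, asc, ← h1]
    rw [← h1] at h2
    linear_combination (2 * x * z - (z + b) * z * q ^ (n + 1)) * h2 +
      (asc z b q x n * z ^ n) * (1 - b * z * q ^ n) * hx

end Algebra

/-! ### Growth of finite products and polynomials -/

section Bounds

variable {K : Type*} [RCLike K]

lemma norm_qProd_le {a p : K} (hp : ‖p‖ ≤ 1) (n : ℕ) : ‖qProd a p n‖ ≤ (1 + ‖a‖) ^ n := by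
  induction n with
  | zero => simp
  | succ n ih =>
    rw [qProd_succ, norm_mul, pow_succ]
    gcongr
    refine (norm_sub_le _ _).trans ?_
    rw [norm_one, norm_mul, norm_pow]
    gcongr
    exact mul_le_of_le_one_right (norm_nonneg _) (pow_le_one₀ (norm_nonneg _) hp)

lemma one_sub_mul_pow_ne_zero {a p : K} (ha : ‖a‖ < 1) (hp : ‖p‖ ≤ 1) (n : ℕ) :
    1 - a * p ^ n ≠ 0 := by
  intro h
  have h1 : ‖a * p ^ n‖ = 1 := by rw [← sub_eq_zero.mp h, norm_one]
  rw [norm_mul, norm_pow] at h1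
  have := mul_le_of_le_one_right (norm_nonneg a) (pow_le_one₀ (norm_nonneg p) hp (n := n))
  linarith

lemma qProd_ne_zero {a p : K} (ha : ‖a‖ < 1) (hp : ‖p‖ ≤ 1) (n : ℕ) : qProd a p n ≠ 0 :=
  Finset.prod_ne_zero_iff.mpr fun j _ => one_sub_mul_pow_ne_zero ha hp j

lemma norm_inv_qProd_le {a p : K} {c : ℝ} (ha : ‖a‖ ≤ c) (hc : c < 1) (hp : ‖p‖ ≤ 1) (n : ℕ) :
    ‖(qProd a p n)⁻¹‖ ≤ ((1 - c)⁻¹) ^ n := by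
  induction n with
  | zero => simp
  | succ n ih =>
    rw [qProd_succ, mul_inv, norm_mul, pow_succ]
    have h0 : 0 < 1 - c := by linarith
    gcongr
    rw [norm_inv]
    gcongr
    have h1 := norm_sub_norm_le 1 (a * p ^ n)
    rw [norm_one, norm_mul, norm_pow] at h1
    have := mul_le_of_le_one_right (norm_nonneg a) (pow_le_one₀ (norm_nonneg p) hp (n := n))
    linarith

/-- On `|x| ≤ 1` the Al-Salam–Chihara polynomials grow at most geometrically. -/
lemma norm_asc_le {a b q x : K} {c : ℝ} (hx : ‖x‖ ≤ 1) (hq : ‖q‖ ≤ 1) (ha : ‖a‖ ≤ c)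
    (hb : ‖b‖ ≤ c) (n : ℕ) : ‖asc a b q x n‖ ≤ (4 + 2 * c + 2 * c ^ 2) ^ n := by
  have hc : 0 ≤ c := (norm_nonneg _).trans ha
  have hqn : ∀ n : ℕ, ‖q‖ ^ n ≤ 1 := fun n => pow_le_one₀ (norm_nonneg q) hq
  have hlin : ∀ n : ℕ, ‖2 * x - (a + b) * q ^ n‖ ≤ 2 + 2 * c := by
    intro n
    calc ‖2 * x - (a + b) * q ^ n‖ ≤ ‖2 * x‖ + ‖(a + b) * q ^ n‖ := norm_sub_le _ _
      _ = 2 * ‖x‖ + ‖a + b‖ * ‖q‖ ^ n := by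
        rw [norm_mul, norm_mul, norm_pow, RCLike.norm_two]
      _ ≤ 2 * 1 + (c + c) * 1 := by
        gcongr
        · exact (norm_add_le _ _).trans (add_le_add ha hb)
        · exact hqn n
      _ = _ := by ring
  have hone : ∀ (u : K) (n : ℕ), ‖1 - u * q ^ n‖ ≤ 1 + ‖u‖ := by
    intro u n
    refine (norm_sub_le _ _).trans ?_
    rw [norm_one, norm_mul, norm_pow]
    gcongr
    exact mul_le_of_le_one_right (norm_nonneg _) (hqn n)
  induction n using Nat.twoStepInduction with
  | zero => simp [asc]
  | one =>
    have := hlin 0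
    simp only [pow_zero, mul_one] at this
    simp only [asc, pow_one]
    nlinarith
  | more n h1 h2 =>
    rw [asc]
    have hg : ‖(1 - q ^ (n + 1)) * (1 - a * b * q ^ n)‖ ≤ 2 * (1 + c ^ 2) := by
      rw [norm_mul]
      have e1 := hone 1 (n + 1)
      have e2 := hone (a * b) n
      rw [one_mul, norm_one] at e1
      have e3 : ‖a * b‖ ≤ c ^ 2 := by
        rw [norm_mul, sq]; gcongr
      have : (1 : ℝ) + 1 = 2 := by norm_num
      rw [this] at e1
      gcongr
      linarith
    set C := 4 + 2 * c + 2 * c ^ 2 with hC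
    have hC1 : 1 ≤ C := by rw [hC]; nlinarith
    calc _ ≤ ‖(2 * x - (a + b) * q ^ (n + 1)) * asc a b q x (n + 1)‖ +
          ‖(1 - q ^ (n + 1)) * (1 - a * b * q ^ n) * asc a b q x n‖ := norm_sub_le _ _
      _ ≤ (2 + 2 * c) * C ^ (n + 1) + 2 * (1 + c ^ 2) * C ^ n := by
        rw [norm_mul, norm_mul _ (asc a b q x n)]
        gcongr
        exact hlin _
      _ ≤ (2 + 2 * c) * C ^ (n + 1) + 2 * (1 + c ^ 2) * C ^ (n + 1) := by
        gcongr
        exact Nat.le_succ n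
      _ = C ^ (n + 2) := by rw [hC]; ring

end Bounds

/-- The Gaussian factor `r ^ (n choose 2)` beats every geometric factor. -/
lemma summable_pow_choose_mul_pow {r : ℝ} (hr0 : 0 < r) (hr1 : r < 1) (C : ℝ) :
    Summable fun n : ℕ => r ^ (n.choose 2) * C ^ n := by
  rcases eq_or_ne C 0 with rfl | hC
  · refine summable_of_ne_finset_zero (s := {0}) fun n hn => ?_
    rw [Finset.mem_singleton] at hn
    simp [hn]
  refine summable_of_ratio_test_tendsto_lt_one (l := 0) one_pos
    (Eventually.of_forall fun n => by positivity) ?_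
  have : (fun n : ℕ => ‖r ^ ((n + 1).choose 2) * C ^ (n + 1)‖ / ‖r ^ (n.choose 2) * C ^ n‖) =
      fun n => r ^ n * |C| := by
    funext n
    rw [← norm_div, Nat.choose_succ_succ' n 1, Nat.choose_one_right, pow_add, pow_succ]
    rw [show r ^ n * r ^ (n.choose (1 + 1)) * (C ^ n * C) / (r ^ (n.choose 2) * C ^ n) =
      r ^ n * C by field_simp, Real.norm_eq_abs, abs_mul, abs_of_pos (by positivity)]
  rw [this]
  simpa using (tendsto_pow_atTop_nhds_zero_of_lt_one hr0.le hr1).mul_const |C|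

/-! ### Infinite products -/

lemma tendsto_qProd {p : ℝ} (hp0 : 0 ≤ p) (hp1 : p < 1) (z : ℂ) :
    Tendsto (qProd z (p : ℂ)) atTop (𝓝 (qPochInf z p)) := by
  have hs : Summable fun j : ℕ => ‖-(z * (p : ℂ) ^ j)‖ := by
    simp only [norm_neg, norm_mul, norm_pow, Complex.norm_real, Real.norm_eq_abs,
      abs_of_nonneg hp0]
    exact (summable_geometric_of_lt_one hp0 hp1).mul_left _
  have := (multipliable_one_add_of_summable hs).tendsto_prod_tprod_nat
  simp only [← sub_eq_add_neg] at this
  exact this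

lemma qPochInf_ne_zero {p : ℝ} (hp0 : 0 ≤ p) (hp1 : p < 1) {z : ℂ}
    (hz : ∀ j : ℕ, 1 - z * (p : ℂ) ^ j ≠ 0) : qPochInf z p ≠ 0 := by
  have hs : Summable fun j : ℕ => ‖-(z * (p : ℂ) ^ j)‖ := by
    simp only [norm_neg, norm_mul, norm_pow, Complex.norm_real, Real.norm_eq_abs,
      abs_of_nonneg hp0]
    exact (summable_geometric_of_lt_one hp0 hp1).mul_left _
  have := tprod_one_add_ne_zero_of_summable (f := fun j : ℕ => -(z * (p : ℂ) ^ j))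
    (fun j => by simpa only [← sub_eq_add_neg] using hz j) hs
  simp only [← sub_eq_add_neg] at this
  exact this

/-- Euler's identity `(p; p²)_∞ (-p; p)_∞ = 1`. -/
lemma qPochInf_euler {p : ℝ} (hp0 : 0 ≤ p) (hp1 : p < 1) :
    qPochInf (p : ℂ) (p ^ 2) * qPochInf (-(p : ℂ)) p = 1 := by
  have hnp : ‖(p : ℂ)‖ < 1 := by rwa [Complex.norm_real, Real.norm_eq_abs, abs_of_nonneg hp0]
  have hne : qPochInf (p : ℂ) p ≠ 0 :=
    qPochInf_ne_zero hp0 hp1 (one_sub_mul_pow_ne_zero hnp hnp.le)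
  have h1 := tendsto_qProd (p := p ^ 2) (by positivity) (by nlinarith) (p : ℂ)
  have h2 := tendsto_qProd hp0 hp1 (-(p : ℂ))
  have h3 := tendsto_qProd hp0 hp1 (p : ℂ)
  have h4 := h3.comp (tendsto_id.const_mul_atTop' (r := 2) two_pos)
  have h5 := (h1.mul h2).mul h3
  have : (fun n => qProd (p : ℂ) ((p ^ 2 : ℝ) : ℂ) n * qProd (-(p : ℂ)) p n * qProd (p : ℂ) p n) =
      qProd (p : ℂ) (p : ℂ) ∘ fun n => 2 * id n := by
    funext n
    simp only [Function.comp, id]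
    rw [qProd_two_mul, ← sq, qProd_sq]
    push_cast
    ring
  rw [this] at h5
  exact mul_right_cancel₀ hne ((tendsto_nhds_unique h5 h4).trans (one_mul _).symm)

/-- Two series whose terms differ by the increments of a null sequence have the same sum. -/
lemma tsum_eq_of_telescope {K : Type*} [RCLike K] {f g W : ℕ → K} (hf : Summable f) (hg : Summable g)
    (hW : Tendsto W atTop (𝓝 0)) (h0 : f 0 = g 0 + W 0)
    (hs : ∀ n, f (n + 1) = g (n + 1) + W (n + 1) - W n) : ∑' n, f n = ∑' n, g n := by
  have h : ∀ n, ∑ i ∈ Finset.range (n + 1), f i = ∑ i ∈ Finset.range (n + 1), g i + W n := by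
    intro n
    induction n with
    | zero => simpa using h0
    | succ n ih => rw [Finset.sum_range_succ, ih, Finset.sum_range_succ _ (n + 1), hs]; ring
  have h1 := (tendsto_add_atTop_iff_nat 1).mpr hf.hasSum.tendsto_sum_nat
  have h2 := ((tendsto_add_atTop_iff_nat 1).mpr hg.hasSum.tendsto_sum_nat).add hW
  simp only [h] at h1
  simpa using tendsto_nhds_unique h1 h2

/-! ### The summable `₁φ₁` series -/

/-- The terms of `₁φ₁(A; Aw; p, w)`. -/
def onePhiOneTerm (A w p : ℂ) (n : ℕ) : ℂ :=
  qProd A p n * (-w) ^ n * p ^ (n.choose 2) / (qProd p p n * qProd (A * w) p n)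

lemma norm_onePhiOneTerm_le {p c : ℝ} (hp0 : 0 < p) (hp1 : p < 1) (hc : c < 1) {A w w' : ℂ}
    (hA : ‖A * w'‖ ≤ c) (hw : ‖w'‖ ≤ ‖w‖) (n : ℕ) :
    ‖onePhiOneTerm A w' p n‖ ≤
      p ^ (n.choose 2) * ((1 + ‖A‖) * ‖w‖ * (1 - p)⁻¹ * (1 - c)⁻¹) ^ n := by
  have hnp : ‖(p : ℂ)‖ = p := by rw [Complex.norm_real, Real.norm_eq_abs, abs_of_pos hp0]
  have hc' : 0 < 1 - c := by linarith
  have hp' : 0 < 1 - p := by linarith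
  calc ‖onePhiOneTerm A w' p n‖ = p ^ (n.choose 2) * (‖qProd A (p : ℂ) n‖ * ‖w'‖ ^ n *
        ‖(qProd (p : ℂ) p n)⁻¹‖ * ‖(qProd (A * w') (p : ℂ) n)⁻¹‖) := by
        rw [onePhiOneTerm, div_eq_mul_inv, mul_inv]
        simp only [norm_mul, norm_pow, norm_neg, hnp]
        ring
    _ ≤ p ^ (n.choose 2) * ((1 + ‖A‖) ^ n * ‖w‖ ^ n * ((1 - p)⁻¹) ^ n * ((1 - c)⁻¹) ^ n) := by
        gcongr
        · exact norm_qProd_le (hnp.trans_le hp1.le) n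
        · exact norm_inv_qProd_le hnp.le hp1 (hnp.trans_le hp1.le) n
        · exact norm_inv_qProd_le hA hc (hnp.trans_le hp1.le) n
    _ = _ := by rw [mul_pow, mul_pow, mul_pow]

lemma summable_onePhiOneTerm {p : ℝ} (hp0 : 0 < p) (hp1 : p < 1) {A w : ℂ} (hA : ‖A * w‖ < 1) :
    Summable (onePhiOneTerm A w p) :=
  Summable.of_norm_bounded (summable_pow_choose_mul_pow hp0 hp1 _)
    fun n => norm_onePhiOneTerm_le hp0 hp1 hA le_rfl le_rfl n

lemma norm_mul_pow_le {p : ℝ} (hp0 : 0 ≤ p) (hp1 : p ≤ 1) (w : ℂ) (k : ℕ) :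
    ‖w * (p : ℂ) ^ k‖ ≤ ‖w‖ := by
  rw [norm_mul, norm_pow, Complex.norm_real, Real.norm_eq_abs, abs_of_nonneg hp0]
  exact mul_le_of_le_one_right (norm_nonneg _) (pow_le_one₀ hp0 hp1)

lemma tsum_onePhiOneTerm_shift {p : ℝ} (hp0 : 0 < p) (hp1 : p < 1) {A w : ℂ} (hA : ‖A * w‖ < 1) :
    (1 - A * w) * ∑' n, onePhiOneTerm A w p n =
      (1 - w) * ∑' n, onePhiOneTerm A (w * p) p n := by
  have hnp : ‖(p : ℂ)‖ = p := by rw [Complex.norm_real, Real.norm_eq_abs, abs_of_pos hp0]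
  have hnp1 : ‖(p : ℂ)‖ < 1 := by rwa [hnp]
  have hAp : ‖A * (w * p)‖ < 1 := by
    have := norm_mul_pow_le hp0.le hp1.le (A * w) 1
    rw [pow_one, mul_assoc] at this
    exact this.trans_lt hA
  have hs := summable_onePhiOneTerm hp0 hp1 hA
  rw [← tsum_mul_left, ← tsum_mul_left]
  have hC := one_sub_mul_pow_ne_zero hA hnp1.le
  have hC' := qProd_ne_zero hA hnp1.le
  have hC'' := qProd_ne_zero hAp hnp1.le
  have hP := qProd_ne_zero hnp1 hnp1.le
  have hp := one_sub_mul_pow_ne_zero hnp1 hnp1.le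
  have hC0 : 1 - A * w ≠ 0 := by simpa using hC 0
  -- the term at `w p`, expressed through the term at `w`
  have hshift : ∀ n, onePhiOneTerm A (w * p) p n =
      onePhiOneTerm A w p n * ((p : ℂ) ^ n * (1 - A * w) / (1 - A * w * p ^ n)) := by
    intro n
    have e : (1 - A * w) * qProd (A * (w * p)) (p : ℂ) n =
        qProd (A * w) (p : ℂ) n * (1 - A * w * p ^ n) := by
      rw [← qProd_succ, qProd_succ', mul_assoc]
    have e' : qProd (A * (w * p)) (p : ℂ) n =
        qProd (A * w) (p : ℂ) n * (1 - A * w * p ^ n) / (1 - A * w) := by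
      rw [← e]; field_simp
    rw [onePhiOneTerm, onePhiOneTerm, e']
    have := hP n
    have := hC n
    have := hC' n
    field_simp
    ring
  have hsucc : ∀ n, (1 - (p : ℂ) ^ (n + 1)) * onePhiOneTerm A w p (n + 1) =
      onePhiOneTerm A w p n * ((1 - A * p ^ n) * (-w) * p ^ n / (1 - A * w * p ^ n)) := by
    intro n
    rw [onePhiOneTerm, onePhiOneTerm, qProd_succ, qProd_succ, qProd_succ,
      Nat.choose_succ_succ' n 1, Nat.choose_one_right]
    have := hP n
    have := hC n
    have := hC' n
    have h1 := hp n
    rw [← pow_succ'] at *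
    field_simp
    ring
  -- with `t n` the term at `w`, the two sides differ by the increments of `(1 - p ^ n) t n`
  refine tsum_eq_of_telescope (hs.mul_left _)
    ((summable_onePhiOneTerm hp0 hp1 hAp).mul_left _)
    (W := fun n => -((1 - A * w) * ((1 - (p : ℂ) ^ (n + 1)) * onePhiOneTerm A w p (n + 1))))
    ?_ ?_ ?_
  · have h1 := (tendsto_add_atTop_iff_nat 1).mpr hs.tendsto_atTop_zero
    have h2 := (tendsto_add_atTop_iff_nat 1).mpr (tendsto_pow_atTop_nhds_zero_of_norm_lt_one hnp1)
    simpa using (((h2.const_sub 1).mul h1).const_mul (1 - A * w)).neg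
  · rw [hsucc, hshift]
    simp only [onePhiOneTerm, qProd_zero, pow_zero, Nat.choose_zero_succ]
    field_simp
    ring
  · intro n
    rw [hsucc n, hsucc (n + 1), hshift]
    have h0 := hsucc n
    have h1 := hC n
    have h2 := hC (n + 1)
    have h3 : (1 - A * w) * ((1 - (p : ℂ) ^ (n + 1)) * onePhiOneTerm A w p (n + 1)) =
      (1 - A * w) * (onePhiOneTerm A w p n *
        ((1 - A * p ^ n) * (-w) * p ^ n / (1 - A * w * p ^ n))) := by rw [h0]
    rw [← h3]
    field_simp
    ring

/-- The summation `₁φ₁(A; C; p, C/A) = (C/A; p)_∞ / (C; p)_∞`, with `C = Aw`. -/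
lemma tsum_onePhiOneTerm {p : ℝ} (hp0 : 0 < p) (hp1 : p < 1) {A w : ℂ} (hA : ‖A * w‖ < 1) :
    qPochInf (A * w) p * ∑' n, onePhiOneTerm A w p n = qPochInf w p := by
  have hnp : ‖(p : ℂ)‖ = p := by rw [Complex.norm_real, Real.norm_eq_abs, abs_of_pos hp0]
  have hnp1 : ‖(p : ℂ)‖ < 1 := by rwa [hnp]
  have hAk : ∀ k : ℕ, ‖A * (w * (p : ℂ) ^ k)‖ ≤ ‖A * w‖ := fun k => by
    rw [← mul_assoc]; exact norm_mul_pow_le hp0.le hp1.le (A * w) k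
  have hk : ∀ k : ℕ, qProd (A * w) (p : ℂ) k * ∑' n, onePhiOneTerm A w p n =
      qProd w (p : ℂ) k * ∑' n, onePhiOneTerm A (w * p ^ k) p n := by
    intro k
    induction k with
    | zero => simp
    | succ k ih =>
      rw [qProd_succ, mul_right_comm, ih, mul_right_comm, mul_assoc, mul_assoc A w,
        tsum_onePhiOneTerm_shift hp0 hp1 ((hAk k).trans_lt hA), qProd_succ, pow_succ, ← mul_assoc w]
      ring
  have hlim : Tendsto (fun k : ℕ => ∑' n, onePhiOneTerm A (w * (p : ℂ) ^ k) p n) atTop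
      (𝓝 (∑' n, onePhiOneTerm A 0 p n)) := by
    refine tendsto_tsum_of_dominated_convergence (summable_pow_choose_mul_pow hp0 hp1 _) ?_
      (Eventually.of_forall fun k n =>
        norm_onePhiOneTerm_le hp0 hp1 hA (hAk k) (norm_mul_pow_le hp0.le hp1.le w k) n)
    intro n
    have hw : Tendsto (fun k : ℕ => w * (p : ℂ) ^ k) atTop (𝓝 0) := by
      simpa using (tendsto_pow_atTop_nhds_zero_of_norm_lt_one hnp1).const_mul w
    have hcont : ContinuousAt (fun v => onePhiOneTerm A v p n) 0 := by
      unfold onePhiOneTerm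
      refine ContinuousAt.div ?_ ?_ ?_
      · fun_prop
      · unfold qProd
        fun_prop
      · rw [mul_zero]
        exact mul_ne_zero (qProd_ne_zero hnp1 hnp1.le n) (by simp [qProd_zero_left])
    exact hcont.tendsto.comp hw
  have h0 : ∑' n, onePhiOneTerm A 0 p n = 1 := by
    rw [tsum_eq_single 0 fun n hn => by simp [onePhiOneTerm, hn]]
    simp [onePhiOneTerm]
  rw [h0] at hlim
  have h1 := (tendsto_qProd hp0.le hp1 (A * w)).mul_const (∑' n, onePhiOneTerm A w p n)
  simp only [hk] at h1
  simpa using tendsto_nhds_unique h1 ((tendsto_qProd hp0.le hp1 w).mul hlim)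

/-! ### Evaluation of the generating series `g` -/

/-- The terms `s ^ (n²) Q_n(x; a, as² | s⁴) / ((s⁴; s⁴)_n (-as; s²)_n)` of the series for `g`,
where `s = q ^ (1/4)`; the exponent `n²` is written as `2 (n choose 2) + n`. -/
def gTerm (s : ℝ) (x a : ℂ) (n : ℕ) : ℂ :=
  ((s : ℂ) ^ 2) ^ (n.choose 2) * (s : ℂ) ^ n * asc a (a * (s : ℂ) ^ 2) ((s : ℂ) ^ 4) x n /
    (qProd ((s : ℂ) ^ 4) ((s : ℂ) ^ 4) n * qProd (-(a * s)) ((s : ℂ) ^ 2) n)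

section

variable {s : ℝ} (hs0 : 0 < s) (hs1 : s < 1)
include hs0

lemma norm_ofReal_of_pos : ‖(s : ℂ)‖ = s := by
  rw [Complex.norm_real, Real.norm_eq_abs, abs_of_pos hs0]

include hs1

lemma norm_ofReal_pow_lt_one {k : ℕ} (hk : k ≠ 0) : ‖(s : ℂ) ^ k‖ < 1 := by
  rw [norm_pow, norm_ofReal_of_pos hs0]
  exact pow_lt_one₀ hs0.le hs1 hk

lemma norm_gTerm_le {x a b : ℂ} (hx : ‖x‖ ≤ 1) (hb : ‖b * s‖ < 1) (ha : ‖a‖ ≤ ‖b‖) (n : ℕ) :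
    ‖gTerm s x a n‖ ≤ (s ^ 2) ^ (n.choose 2) *
      (s * (4 + 2 * ‖b‖ + 2 * ‖b‖ ^ 2) * (1 - s ^ 4)⁻¹ * (1 - ‖b * s‖)⁻¹) ^ n := by
  have hns := norm_ofReal_of_pos hs0
  have h4 : s ^ 4 < 1 := pow_lt_one₀ hs0.le hs1 (by norm_num)
  have hs4 : 0 < 1 - s ^ 4 := by linarith
  have hbs : 0 < 1 - ‖b * s‖ := by linarith
  have has : ‖-(a * (s : ℂ))‖ ≤ ‖b * s‖ := by
    rw [norm_neg, norm_mul, norm_mul]; gcongr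
  have hap : ‖a * (s : ℂ) ^ 2‖ ≤ ‖b‖ := (norm_mul_pow_le hs0.le hs1.le a 2).trans ha
  calc ‖gTerm s x a n‖ = (s ^ 2) ^ (n.choose 2) * (s ^ n *
        ‖asc a (a * (s : ℂ) ^ 2) ((s : ℂ) ^ 4) x n‖ *
        ‖(qProd ((s : ℂ) ^ 4) ((s : ℂ) ^ 4) n)⁻¹‖ *
        ‖(qProd (-(a * (s : ℂ))) ((s : ℂ) ^ 2) n)⁻¹‖) := by
        rw [gTerm, div_eq_mul_inv, mul_inv]
        simp only [norm_mul, norm_pow, hns]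
        ring
    _ ≤ (s ^ 2) ^ (n.choose 2) * (s ^ n * (4 + 2 * ‖b‖ + 2 * ‖b‖ ^ 2) ^ n *
        ((1 - s ^ 4)⁻¹) ^ n * ((1 - ‖b * s‖)⁻¹) ^ n) := by
        gcongr
        · exact norm_asc_le hx (norm_ofReal_pow_lt_one hs0 hs1 (by norm_num)).le ha hap n
        · exact norm_inv_qProd_le (by rw [norm_pow, hns]) h4
            (norm_ofReal_pow_lt_one hs0 hs1 (by norm_num)).le n
        · exact norm_inv_qProd_le has hb (norm_ofReal_pow_lt_one hs0 hs1 (by norm_num)).le n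
    _ = _ := by rw [mul_pow, mul_pow, mul_pow]

lemma summable_gTerm {x a : ℂ} (hx : ‖x‖ ≤ 1) (ha : ‖a * s‖ < 1) : Summable (gTerm s x a) :=
  Summable.of_norm_bounded
    (summable_pow_choose_mul_pow (by positivity) (pow_lt_one₀ hs0.le hs1 (by norm_num)) _)
    fun n => norm_gTerm_le hs0 hs1 hx ha le_rfl n

/-- Replacing `a` by `a q ^ (1/2)` multiplies the series by `1 + a q ^ (1/4)`; this is the
contiguous relation of the polynomials, summed. -/
lemma tsum_gTerm_shift {x a : ℂ} (hx : ‖x‖ ≤ 1) (ha : ‖a * s‖ < 1) :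
    (1 - -(a * s)) * ∑' n, gTerm s x a n = ∑' n, gTerm s x (a * (s : ℂ) ^ 2) n := by
  have hp := norm_ofReal_pow_lt_one hs0 hs1 (k := 2) (by norm_num)
  have hq := norm_ofReal_pow_lt_one hs0 hs1 (k := 4) (by norm_num)
  have ha' : ‖-(a * (s : ℂ))‖ < 1 := by rwa [norm_neg]
  have hap : ‖a * (s : ℂ) ^ 2 * s‖ < 1 := by
    rw [mul_right_comm]
    exact (norm_mul_pow_le hs0.le hs1.le _ 2).trans_lt ha
  have hsg := summable_gTerm hs0 hs1 hx hap
  rw [← tsum_mul_left]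
  -- the increments come from the last term of the contiguous relation, whose index is shifted by 1
  refine tsum_eq_of_telescope ((summable_gTerm hs0 hs1 hx ha).mul_left _) hsg
    (W := fun n => a * s * ((s : ℂ) ^ 2) ^ n * gTerm s x (a * (s : ℂ) ^ 2) n) ?_ ?_ ?_
  · have := ((tendsto_pow_atTop_nhds_zero_of_norm_lt_one hp).const_mul (a * (s : ℂ))).mul
      hsg.tendsto_atTop_zero
    simpa using this
  · simp [gTerm, asc]
  · intro n
    have e : ∀ m, qProd (-(a * (s : ℂ) ^ 2 * s)) ((s : ℂ) ^ 2) m =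
        qProd (-(a * (s : ℂ))) ((s : ℂ) ^ 2) m * (1 - -(a * s) * ((s : ℂ) ^ 2) ^ m) /
          (1 - -(a * s)) := by
      intro m
      have h0 : 1 - -(a * (s : ℂ)) ≠ 0 := by simpa using one_sub_mul_pow_ne_zero ha' hp.le 0
      rw [eq_div_iff h0, ← qProd_succ, qProd_succ', mul_comm]
      congr 2
      ring
    have hc : asc a (a * (s : ℂ) ^ 2) ((s : ℂ) ^ 4) x (n + 1) =
        asc (a * (s : ℂ) ^ 2) (a * (s : ℂ) ^ 2 * (s : ℂ) ^ 2) ((s : ℂ) ^ 4) x (n + 1) -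
        a * (1 - ((s : ℂ) ^ 4) ^ (n + 1)) *
          asc (a * (s : ℂ) ^ 2) (a * (s : ℂ) ^ 2 * (s : ℂ) ^ 2) ((s : ℂ) ^ 4) x n := by
      rw [asc_contiguous, asc_comm (a * (s : ℂ) ^ 4),  asc_comm (a * (s : ℂ) ^ 4)]
      ring_nf
    have h0 : 1 - -(a * (s : ℂ)) ≠ 0 := by simpa using one_sub_mul_pow_ne_zero ha' hp.le 0
    have h1 := one_sub_mul_pow_ne_zero ha' hp.le n
    have h2 := one_sub_mul_pow_ne_zero ha' hp.le (n + 1)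
    have h3 := qProd_ne_zero ha' hp.le n
    have h4 := qProd_ne_zero hq hq.le n
    have h5 := one_sub_mul_pow_ne_zero hq hq.le n
    have hsne : (s : ℂ) ≠ 0 := by exact_mod_cast hs0.ne'
    simp only [gTerm, e, hc, qProd_succ _ _ n, Nat.choose_succ_succ' n 1, Nat.choose_one_right]
    generalize asc (a * (s : ℂ) ^ 2) (a * (s : ℂ) ^ 2 * (s : ℂ) ^ 2) ((s : ℂ) ^ 4) x (n + 1) = Q1
    generalize asc (a * (s : ℂ) ^ 2) (a * (s : ℂ) ^ 2 * (s : ℂ) ^ 2) ((s : ℂ) ^ 4) x n = Q0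
    generalize qProd (-(a * (s : ℂ))) ((s : ℂ) ^ 2) n = R at *
    generalize qProd ((s : ℂ) ^ 4) ((s : ℂ) ^ 4) n = S at *
    have e4 : ((s : ℂ) ^ 4) ^ n = (((s : ℂ) ^ 2) ^ n) ^ 2 := by
      rw [← pow_mul, ← pow_mul, ← pow_mul]; ring_nf
    rw [e4] at h5
    rw [pow_succ ((s : ℂ) ^ 2) n] at h2
    rw [pow_succ ((s : ℂ) ^ 2) n, pow_succ ((s : ℂ) ^ 4) n, e4, pow_add ((s : ℂ) ^ 2),
      pow_succ (s : ℂ) n]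
    clear e hc e4
    generalize ((s : ℂ) ^ 2) ^ (n.choose (1 + 1)) = D
    generalize ((s : ℂ) ^ 2) ^ n = P at *
    generalize (s : ℂ) ^ n = N
    generalize (s : ℂ) = t at *
    have h2' : 1 + a * t ^ 3 * P ≠ 0 := by convert h2 using 1; ring
    have h1' : 1 + a * t * P ≠ 0 := by convert h1 using 1; ring
    simp only [neg_mul, sub_neg_eq_add] at h0 ⊢
    rw [show a * t * (P * t ^ 2) = a * t ^ 3 * P by ring]
    field_simp

omit hs0 hs1 in
lemma continuous_asc (q x t : ℂ) (n : ℕ) : Continuous fun a : ℂ => asc a (a * t) q x n := by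
  induction n using Nat.twoStepInduction with
  | zero => simp only [asc]; fun_prop
  | one => simp only [asc]; fun_prop
  | more n h1 h2 => simp only [asc]; fun_prop

/-- Up to the factor `(-a q ^ (1/4); q ^ (1/2))_∞` the series does not depend on `a`. -/
lemma qPochInf_mul_tsum_gTerm {x a : ℂ} (hx : ‖x‖ ≤ 1) (ha : ‖a * s‖ < 1) :
    qPochInf (-(a * s)) (s ^ 2) * ∑' n, gTerm s x a n = ∑' n, gTerm s x 0 n := by
  have hp := norm_ofReal_pow_lt_one hs0 hs1 (k := 2) (by norm_num)
  have hq := norm_ofReal_pow_lt_one hs0 hs1 (k := 4) (by norm_num)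
  have hp0 : 0 ≤ s ^ 2 := by positivity
  have hp1 : s ^ 2 < 1 := pow_lt_one₀ hs0.le hs1 (by norm_num)
  have hak : ∀ k : ℕ, ‖a * ((s : ℂ) ^ 2) ^ k‖ ≤ ‖a‖ := fun k => by
    have := norm_mul_pow_le hp0 hp1.le a k
    push_cast at this
    exact this
  have hk : ∀ k : ℕ, qProd (-(a * (s : ℂ))) ((s : ℂ) ^ 2) k * ∑' n, gTerm s x a n =
      ∑' n, gTerm s x (a * ((s : ℂ) ^ 2) ^ k) n := by
    intro k
    induction k with
    | zero => simp
    | succ k ih =>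
      have hlt : ‖a * ((s : ℂ) ^ 2) ^ k * s‖ < 1 := by
        refine lt_of_le_of_lt ?_ ha
        rw [norm_mul, norm_mul a s]
        exact mul_le_mul_of_nonneg_right (hak k) (norm_nonneg _)
      rw [qProd_succ, mul_right_comm, ih, pow_succ ((s : ℂ) ^ 2) k, ← mul_assoc a,
        ← tsum_gTerm_shift hs0 hs1 hx hlt]
      ring
  have hlim : Tendsto (fun k : ℕ => ∑' n, gTerm s x (a * ((s : ℂ) ^ 2) ^ k) n) atTop
      (𝓝 (∑' n, gTerm s x 0 n)) := by
    refine tendsto_tsum_of_dominated_convergence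
      (summable_pow_choose_mul_pow (by positivity) hp1 _) ?_
      (Eventually.of_forall fun k n => norm_gTerm_le hs0 hs1 hx ha (hak k) n)
    intro n
    have hw : Tendsto (fun k : ℕ => a * ((s : ℂ) ^ 2) ^ k) atTop (𝓝 0) := by
      simpa using (tendsto_pow_atTop_nhds_zero_of_norm_lt_one hp).const_mul a
    have hcont : ContinuousAt (fun v => gTerm s x v n) 0 := by
      unfold gTerm
      refine ContinuousAt.div ?_ ?_ ?_
      · exact ((continuous_asc _ _ _ n).const_mul _).continuousAt
      · unfold qProd
        fun_prop
      · exact mul_ne_zero (qProd_ne_zero hq hq.le n) (by simp [qProd_zero_left])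
    exact hcont.tendsto.comp hw
  have h1 := (tendsto_qProd hp0 hp1 (-(a * s))).mul_const (∑' n, gTerm s x a n)
  push_cast at h1
  simp only [hk] at h1
  exact tendsto_nhds_unique h1 hlim

/-- For `a = z = e^{iθ}` the polynomials factor, and the series becomes a `₁φ₁` series. -/
lemma gTerm_eq_onePhiOneTerm {x z : ℂ} (hz : ‖z‖ = 1) (hxz : 2 * x * z = z ^ 2 + 1) (n : ℕ) :
    gTerm s x z n = onePhiOneTerm (z * s) (-(s / z)) ((s ^ 2 : ℝ) : ℂ) n := by
  have hp := norm_ofReal_pow_lt_one hs0 hs1 (k := 2) (by norm_num)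
  have hz0 : z ≠ 0 := by rintro rfl; simp at hz
  have hzs : ‖-(z * (s : ℂ))‖ < 1 := by
    rw [norm_neg, norm_mul, hz, one_mul, norm_ofReal_of_pos hs0]; exact hs1
  have h1 := qProd_ne_zero hzs hp.le n
  have h2 := qProd_ne_zero hp hp.le n
  have h3 := qProd_ne_zero (a := -(s : ℂ) ^ 2) (by rwa [norm_neg]) hp.le n
  have hA : asc z (z * (s : ℂ) ^ 2) ((s : ℂ) ^ 4) x n =
      qProd (z * s) ((s : ℂ) ^ 2) n * qProd (-(z * s)) ((s : ℂ) ^ 2) n / z ^ n := by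
    rw [eq_div_iff (pow_ne_zero _ hz0), asc_mul_pow hxz, ← qProd_sq]
    ring_nf
  have hS : qProd ((s : ℂ) ^ 4) ((s : ℂ) ^ 4) n =
      qProd ((s : ℂ) ^ 2) ((s : ℂ) ^ 2) n * qProd (-(s : ℂ) ^ 2) ((s : ℂ) ^ 2) n := by
    rw [← qProd_sq]; ring_nf
  have hC : z * (s : ℂ) * -((s : ℂ) / z) = -(s : ℂ) ^ 2 := by field_simp
  rw [gTerm, onePhiOneTerm, hA, hS]
  push_cast
  rw [hC, neg_neg, div_pow]
  generalize qProd (-(z * (s : ℂ))) ((s : ℂ) ^ 2) n = R at *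
  field_simp

/-- The product formula for `g`: the value at `a` is computed from the one at `z = e^{iθ}`. -/
theorem tsum_gTerm {x a z : ℂ} (hx : ‖x‖ ≤ 1) (ha : ‖a * s‖ < 1) (hz : ‖z‖ = 1)
    (hxz : 2 * x * z = z ^ 2 + 1) :
    ∑' n, gTerm s x a n = qPochInf ((s ^ 2 : ℝ) : ℂ) (s ^ 4) *
      (qPochInf (-(s : ℂ) * z) (s ^ 2) * qPochInf (-(s : ℂ) * z⁻¹) (s ^ 2)) /
        qPochInf (-(a * s)) (s ^ 2) := by
  have hp0 : 0 < s ^ 2 := by positivity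
  have hp1 : s ^ 2 < 1 := pow_lt_one₀ hs0.le hs1 (by norm_num)
  have hp := norm_ofReal_pow_lt_one hs0 hs1 (k := 2) (by norm_num)
  have hz0 : z ≠ 0 := by rintro rfl; simp at hz
  have hzs : ‖z * (s : ℂ)‖ < 1 := by
    rw [norm_mul, hz, one_mul, norm_ofReal_of_pos hs0]; exact hs1
  have hC : z * (s : ℂ) * -((s : ℂ) / z) = -((s ^ 2 : ℝ) : ℂ) := by push_cast; field_simp
  have h0 : qPochInf (-(a * s)) (s ^ 2) ≠ 0 := by
    refine qPochInf_ne_zero hp0.le hp1 fun j => ?_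
    push_cast
    exact one_sub_mul_pow_ne_zero (by rwa [norm_neg]) hp.le j
  have h1 := tsum_onePhiOneTerm hp0 hp1 (A := z * s) (w := -(s / z)) (by
    rw [hC, norm_neg]; push_cast; exact hp)
  rw [hC] at h1
  have h2 := qPochInf_euler hp0.le hp1
  rw [eq_div_iff h0, mul_comm, qPochInf_mul_tsum_gTerm hs0 hs1 hx ha,
    ← qPochInf_mul_tsum_gTerm hs0 hs1 hx hzs,
    tsum_congr (gTerm_eq_onePhiOneTerm hs0 hs1 hz hxz)]
  rw [show s ^ 4 = (s ^ 2) ^ 2 by ring, show -(s : ℂ) * z = -(z * s) by ring,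
    show -(s : ℂ) * z⁻¹ = -(s / z) by rw [div_eq_mul_inv]; ring, ← h1]
  linear_combination (-qPochInf (-(z * s)) (s ^ 2) *
    ∑' n, onePhiOneTerm (z * s) (-(s / z)) ((s ^ 2 : ℝ) : ℂ) n) * h2

end

/-! ### The spectral equation for `G` -/

/-- The squared norms `(q, a² q ^ (1/2); q)_n` of the polynomials, with `q = s⁴`. -/
def ascDen (a s : ℝ) (n : ℕ) : ℝ :=
  qProd (s ^ 4) (s ^ 4) n * qProd (a ^ 2 * s ^ 2) (s ^ 4) n

/-- The polynomials divided by their squared norms. -/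
def dualPoly (a s x : ℝ) (n : ℕ) : ℝ := asc a (a * s ^ 2) (s ^ 4) x n / ascDen a s n

/-- The Gaussian `s ^ ((m - n)²)`, as a quotient of powers with natural exponents. -/
def gaussian (s : ℝ) (m n : ℕ) : ℝ := s ^ (m ^ 2 + n ^ 2) / s ^ (2 * m * n)

/-- The entries of `G` without the normalizing square roots. -/
def gEntry (a s : ℝ) (m n : ℕ) : ℝ := gaussian s m n * qProd (a * s) (s ^ 2) (m + n)

/-- The diagonal coefficient of the recurrence of the polynomials. -/
def recB (a s : ℝ) (n : ℕ) : ℝ := (a + a * s ^ 2) * (s ^ 4) ^ n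

/-- The lower coefficient `(1 - q ^ n) (1 - a² q ^ (n - 1/2))` of the recurrence of the
polynomials; it vanishes for `n = 0`. -/
def recC (a s : ℝ) (n : ℕ) : ℝ := (1 - (s ^ 4) ^ n) * (1 - a ^ 2 / s ^ 2 * (s ^ 4) ^ n)

/-- The entry at `(m, n)` of the product of `G` with the (non-symmetric) Jacobi matrix of the
polynomials. For `n = 0` the meaningless entry at `n - 1` is multiplied by `recC a s 0 = 0`. -/
def jacobiEntry (a s : ℝ) (m n : ℕ) : ℝ :=
  recC a s n * gEntry a s m (n - 1) + recB a s n * gEntry a s m n + gEntry a s m (n + 1)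

lemma recC_zero (a s : ℝ) : recC a s 0 = 0 := by simp [recC]

lemma gaussian_comm (s : ℝ) (m n : ℕ) : gaussian s m n = gaussian s n m := by
  rw [gaussian, gaussian, add_comm, mul_right_comm]

lemma gEntry_comm (a s : ℝ) (m n : ℕ) : gEntry a s m n = gEntry a s n m := by
  rw [gEntry, gEntry, add_comm, gaussian_comm]

section

variable {a s : ℝ}

lemma recC_succ (a s : ℝ) (n : ℕ) :
    recC a s (n + 1) = (1 - (s ^ 4) ^ (n + 1)) * (1 - a * (a * s ^ 2) * (s ^ 4) ^ n) := by
  rw [recC, pow_succ]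
  field_simp

lemma gaussian_succ (hs : s ≠ 0) (m n : ℕ) :
    gaussian s m (n + 1) = gaussian s m n * s * (s ^ 2) ^ n / (s ^ 2) ^ m := by
  rw [gaussian, gaussian]
  field_simp
  ring

/-- Apart from factors depending on `m + n` only, the entry is visibly symmetric in `m` and `n`. -/
lemma jacobiEntry_eq (hs : s ≠ 0) {m n k : ℕ} (h : m + n = k + 1) :
    jacobiEntry a s m n = gaussian s m n * s * ((s ^ 2) ^ m / (s ^ 2) ^ n +
      (s ^ 2) ^ n / (s ^ 2) ^ m - (s ^ 2) ^ m * (s ^ 2) ^ n * (1 + a ^ 2 / s ^ 2)) *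
        qProd (a * s) (s ^ 2) k := by
  cases n with
  | zero =>
    obtain rfl : m = k + 1 := by omega
    rw [jacobiEntry, recC_zero, recB, gEntry, gEntry, gaussian_succ hs]
    simp only [zero_add, pow_zero, qProd_succ]
    rw [pow_succ (s ^ 2) k]
    have hP : (s ^ 2) ^ k ≠ 0 := by positivity
    generalize (s ^ 2) ^ k = P at *
    field_simp
    ring
  | succ n =>
    obtain rfl : k = m + n := by omega
    rw [jacobiEntry, recC_succ, recB, gEntry, gEntry, gEntry, gaussian_succ hs m (n + 1),
      gaussian_succ hs m n, Nat.add_sub_cancel, ← add_assoc m (n + 1) 1, ← add_assoc m n 1,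
      qProd_succ, qProd_succ, qProd_succ]
    have e4 : (s ^ 4) ^ n = ((s ^ 2) ^ n) ^ 2 := by rw [← pow_mul, ← pow_mul, ← pow_mul]; ring_nf
    rw [pow_succ (s ^ 4) n, e4, pow_succ (s ^ 2) (m + n), pow_add (s ^ 2) m n, pow_succ (s ^ 2) n]
    have hP : (s ^ 2) ^ n ≠ 0 := by positivity
    have hQ : (s ^ 2) ^ m ≠ 0 := by positivity
    generalize (s ^ 2) ^ n = P at *
    generalize (s ^ 2) ^ m = Q at *
    field_simp
    ring

/-- `G` commutes with the Jacobi matrix of the polynomials. -/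
lemma jacobiEntry_comm (hs : s ≠ 0) (m n : ℕ) : jacobiEntry a s m n = jacobiEntry a s n m := by
  rcases Nat.eq_zero_or_eq_succ_pred (m + n) with h | h
  · obtain ⟨rfl, rfl⟩ : m = 0 ∧ n = 0 := by omega
    rfl
  · rw [jacobiEntry_eq hs h, jacobiEntry_eq hs ((add_comm n m).trans h), gaussian_comm]
    ring

variable (hs0 : 0 < s) (hs1 : s < 1) (ha : |a * s| < 1)
include hs0 hs1 ha

omit hs0 hs1 in
lemma abs_sq_mul_sq_lt_one : |a ^ 2 * s ^ 2| < 1 := by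
  rw [← mul_pow, abs_pow]
  exact pow_lt_one₀ (abs_nonneg _) ha two_ne_zero

lemma ascDen_ne_zero (n : ℕ) : ascDen a s n ≠ 0 := by
  have h4 : ‖s ^ 4‖ < 1 := by
    rw [Real.norm_eq_abs, abs_of_pos (by positivity)]
    exact pow_lt_one₀ hs0.le hs1 (by norm_num)
  exact mul_ne_zero (qProd_ne_zero h4 h4.le n)
    (qProd_ne_zero (abs_sq_mul_sq_lt_one ha) h4.le n)

omit hs0 hs1 ha in
lemma ascDen_succ (a s : ℝ) (n : ℕ) : ascDen a s (n + 1) = recC a s (n + 1) * ascDen a s n := by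
  rw [ascDen, ascDen, qProd_succ, qProd_succ, recC_succ]
  ring

lemma recC_mul_dualPoly (x : ℝ) (n : ℕ) : recC a s (n + 1) * dualPoly a s x (n + 1) =
    asc a (a * s ^ 2) (s ^ 4) x (n + 1) / ascDen a s n := by
  have h := ascDen_ne_zero hs0 hs1 ha (n + 1)
  have h' := ascDen_ne_zero hs0 hs1 ha n
  rw [ascDen_succ] at h
  have hc := left_ne_zero_of_mul h
  rw [dualPoly, ascDen_succ]
  field_simp

lemma two_mul_dualPoly_zero (x : ℝ) : 2 * x * dualPoly a s x 0 =
    recC a s 1 * dualPoly a s x 1 + recB a s 0 * dualPoly a s x 0 := by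
  rw [recC_mul_dualPoly hs0 hs1 ha, dualPoly, recB]
  simp only [asc]
  ring

lemma two_mul_dualPoly_succ (x : ℝ) (n : ℕ) : 2 * x * dualPoly a s x (n + 1) =
    recC a s (n + 2) * dualPoly a s x (n + 2) + recB a s (n + 1) * dualPoly a s x (n + 1) +
      dualPoly a s x n := by
  have h' := ascDen_ne_zero hs0 hs1 ha n
  have h := ascDen_ne_zero hs0 hs1 ha (n + 1)
  rw [recC_mul_dualPoly hs0 hs1 ha, dualPoly, dualPoly, recB, asc, ← recC_succ]
  rw [ascDen_succ] at h ⊢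
  have hc := left_ne_zero_of_mul h
  field_simp
  ring

lemma exists_abs_dualPoly_le : ∃ K : ℝ, 0 < K ∧
    ∀ x : ℝ, |x| ≤ 1 → ∀ n, |dualPoly a s x n| ≤ K ^ n := by
  have h4' : s ^ 4 < 1 := pow_lt_one₀ hs0.le hs1 (by norm_num)
  have h4 : ‖s ^ 4‖ ≤ s ^ 4 := by rw [Real.norm_eq_abs, abs_of_pos (by positivity)]
  have h2 := abs_sq_mul_sq_lt_one ha
  have h2' : 0 < 1 - |a ^ 2 * s ^ 2| := by linarith
  have h4'' : 0 < 1 - s ^ 4 := by linarith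
  have hb : ‖a * s ^ 2‖ ≤ |a| := by
    rw [norm_mul, norm_pow, Real.norm_eq_abs, Real.norm_eq_abs, abs_of_pos hs0]
    exact mul_le_of_le_one_right (abs_nonneg a) (pow_le_one₀ hs0.le hs1.le)
  refine ⟨(4 + 2 * |a| + 2 * |a| ^ 2) * ((1 - s ^ 4)⁻¹ * (1 - |a ^ 2 * s ^ 2|)⁻¹),
    by positivity, fun x hx n => ?_⟩
  rw [dualPoly, ascDen, div_eq_mul_inv, mul_inv, abs_mul, abs_mul, mul_pow, mul_pow]
  gcongr
  · exact norm_asc_le hx (h4.trans h4'.le) le_rfl hb n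
  · exact norm_inv_qProd_le h4 h4' (h4.trans h4'.le) n
  · exact norm_inv_qProd_le (le_refl |a ^ 2 * s ^ 2|) h2 (h4.trans h4'.le) n

omit hs1 ha in
lemma gaussian_eq (m n : ℕ) :
    gaussian s m n = s ^ (m ^ 2) * ((s ^ 2) ^ (n.choose 2) * (s / s ^ (2 * m)) ^ n) := by
  have h : n ^ 2 = 2 * n.choose 2 + n := by
    induction n with
    | zero => rfl
    | succ n ih => rw [Nat.choose_succ_succ' n 1, Nat.choose_one_right]; linarith
  rw [gaussian, h, div_pow, ← pow_mul, ← pow_mul, pow_add, pow_add]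
  field_simp

omit ha in
lemma exists_abs_gEntry_le (m : ℕ) : ∃ c L : ℝ, 0 < c ∧ 0 < L ∧
    ∀ n, |gEntry a s m n| ≤ c * ((s ^ 2) ^ (n.choose 2) * L ^ n) := by
  refine ⟨s ^ (m ^ 2) * (1 + |a * s|) ^ m, s / s ^ (2 * m) * (1 + |a * s|), by positivity,
    by positivity, fun n => ?_⟩
  have h2 : ‖s ^ 2‖ ≤ 1 := by
    rw [Real.norm_eq_abs, abs_of_pos (by positivity)]
    exact pow_le_one₀ hs0.le hs1.le
  have h := norm_qProd_le (a := a * s) h2 (m + n)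
  rw [Real.norm_eq_abs, Real.norm_eq_abs] at h
  rw [gEntry, abs_mul, gaussian_eq hs0, abs_of_pos (by positivity)]
  refine (mul_le_mul_of_nonneg_left h (by positivity)).trans_eq ?_
  rw [pow_add, mul_pow _ (1 + |a * s|)]
  ring

lemma summable_gEntry_mul {x : ℝ} (hx : |x| ≤ 1) (m : ℕ) :
    Summable fun n => gEntry a s m n * dualPoly a s x n := by
  obtain ⟨K, hK0, hK⟩ := exists_abs_dualPoly_le hs0 hs1 ha
  obtain ⟨c, L, hc, hL, hG⟩ := exists_abs_gEntry_le hs0 hs1 m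
  refine Summable.of_norm_bounded ((summable_pow_choose_mul_pow (r := s ^ 2) (by positivity)
    (pow_lt_one₀ hs0.le hs1 (by norm_num)) (L * K)).mul_left c) fun n => ?_
  rw [norm_mul, mul_pow, ← mul_assoc ((s ^ 2) ^ n.choose 2), ← mul_assoc c]
  exact mul_le_mul (hG n) (hK x hx n) (abs_nonneg _) (by positivity)

lemma tendsto_gEntry_mul_succ {x : ℝ} (hx : |x| ≤ 1) (m : ℕ) :
    Tendsto (fun n => gEntry a s m n * dualPoly a s x (n + 1)) atTop (𝓝 0) := by
  obtain ⟨K, hK0, hK⟩ := exists_abs_dualPoly_le hs0 hs1 ha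
  obtain ⟨c, L, hc, hL, hG⟩ := exists_abs_gEntry_le hs0 hs1 m
  refine Summable.tendsto_atTop_zero (Summable.of_norm_bounded
    ((summable_pow_choose_mul_pow (r := s ^ 2) (by positivity)
    (pow_lt_one₀ hs0.le hs1 (by norm_num)) (L * K)).mul_left (c * K)) fun n => ?_)
  rw [norm_mul, mul_pow]
  refine (mul_le_mul (hG n) (hK x hx (n + 1)) (abs_nonneg _) (by positivity)).trans_eq ?_
  ring

lemma tendsto_gEntry_succ_mul {x : ℝ} (hx : |x| ≤ 1) (m : ℕ) :
    Tendsto (fun n => gEntry a s m (n + 1) * dualPoly a s x n) atTop (𝓝 0) := by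
  obtain ⟨K, hK0, hK⟩ := exists_abs_dualPoly_le hs0 hs1 ha
  obtain ⟨c, L, hc, hL, hG⟩ := exists_abs_gEntry_le hs0 hs1 m
  have := ((summable_nat_add_iff 1).mpr (summable_pow_choose_mul_pow (r := s ^ 2) (by positivity)
    (pow_lt_one₀ hs0.le hs1 (by norm_num)) (L * K))).mul_left (c / K)
  refine Summable.tendsto_atTop_zero (Summable.of_norm_bounded this fun n => ?_)
  rw [norm_mul, mul_pow]
  refine (mul_le_mul (hG (n + 1)) (hK x hx n) (abs_nonneg _) (by positivity)).trans_eq ?_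
  field_simp
  ring

/-- The rows of `G`, paired with the polynomials, satisfy the recurrence of the polynomials. -/
lemma tsum_gEntry_recurrence {x : ℝ} (hx : |x| ≤ 1) (m : ℕ) :
    recC a s m * ∑' n, gEntry a s (m - 1) n * dualPoly a s x n +
      recB a s m * ∑' n, gEntry a s m n * dualPoly a s x n +
      ∑' n, gEntry a s (m + 1) n * dualPoly a s x n =
    2 * x * ∑' n, gEntry a s m n * dualPoly a s x n := by
  have hS := summable_gEntry_mul hs0 hs1 ha hx
  rw [← tsum_mul_left, ← tsum_mul_left, ← tsum_mul_left,
    ← ((hS _).mul_left _).tsum_add ((hS _).mul_left _),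
    ← (((hS _).mul_left _).add ((hS _).mul_left _)).tsum_add (hS _)]
  have hrow : ∀ n, recC a s m * (gEntry a s (m - 1) n * dualPoly a s x n) +
      recB a s m * (gEntry a s m n * dualPoly a s x n) + gEntry a s (m + 1) n * dualPoly a s x n =
      jacobiEntry a s m n * dualPoly a s x n := by
    intro n
    rw [jacobiEntry_comm hs0.ne', jacobiEntry, gEntry_comm a s n, gEntry_comm a s n m,
      gEntry_comm a s n]
    ring
  -- summation by parts: `W` collects the boundary terms of the two index shifts
  refine tsum_eq_of_telescope ((((hS _).mul_left _).add ((hS _).mul_left _)).add (hS _))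
    ((hS _).mul_left _)
    (W := fun n => gEntry a s m (n + 1) * dualPoly a s x n -
      recC a s (n + 1) * (gEntry a s m n * dualPoly a s x (n + 1))) ?_ ?_ ?_
  · have h4 : Tendsto (fun n : ℕ => (s ^ 4) ^ (n + 1)) atTop (𝓝 0) :=
      (tendsto_add_atTop_iff_nat 1).mpr (tendsto_pow_atTop_nhds_zero_of_lt_one (by positivity)
        (pow_lt_one₀ hs0.le hs1 (by norm_num)))
    have hC : Tendsto (fun n : ℕ => recC a s (n + 1)) atTop (𝓝 1) := by
      simpa [recC] using (h4.const_sub 1).mul ((h4.const_mul (a ^ 2 / s ^ 2)).const_sub 1)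
    simpa using (tendsto_gEntry_succ_mul hs0 hs1 ha hx m).sub
      (hC.mul (tendsto_gEntry_mul_succ hs0 hs1 ha hx m))
  · rw [hrow, mul_left_comm, two_mul_dualPoly_zero hs0 hs1 ha, jacobiEntry, recC_zero]
    ring
  · intro n
    rw [hrow, mul_left_comm, two_mul_dualPoly_succ hs0 hs1 ha, jacobiEntry, Nat.add_sub_cancel]
    ring

/-- A solution of the recurrence is determined by its initial value. -/
lemma tsum_gEntry_eq {x : ℝ} (hx : |x| ≤ 1) (m : ℕ) :
    ∑' n, gEntry a s m n * dualPoly a s x n =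
      (∑' n, gEntry a s 0 n * dualPoly a s x n) * asc a (a * s ^ 2) (s ^ 4) x m := by
  induction m using Nat.twoStepInduction with
  | zero => simp [asc]
  | one =>
    have h := tsum_gEntry_recurrence hs0 hs1 ha hx 0
    rw [recC_zero, recB] at h
    simp only [asc]
    linear_combination h
  | more m h1 h2 =>
    have h := tsum_gEntry_recurrence hs0 hs1 ha hx (m + 1)
    rw [Nat.add_sub_cancel, h1, h2, recC_succ, recB] at h
    rw [asc]
    linear_combination h

end

/-! ### The Hankel parts and Euler's series -/

lemma ofReal_qProd (a p : ℝ) (n : ℕ) : ((qProd a p n : ℝ) : ℂ) = qProd (a : ℂ) p n := by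
  simp [qProd]

lemma tendsto_qProd_real {p : ℝ} (hp0 : 0 ≤ p) (hp1 : p < 1) (a : ℝ) :
    Tendsto (qProd a p) atTop (𝓝 (qPochInfReal a p)) := by
  have hs : Summable fun j : ℕ => ‖-(a * p ^ j)‖ := by
    simp only [norm_neg, norm_mul, norm_pow, Real.norm_eq_abs, abs_of_nonneg hp0]
    exact (summable_geometric_of_lt_one hp0 hp1).mul_left _
  have := (multipliable_one_add_of_summable hs).tendsto_prod_tprod_nat
  simp only [← sub_eq_add_neg] at this
  exact this

lemma ofReal_qPochInfReal {p : ℝ} (hp0 : 0 ≤ p) (hp1 : p < 1) (a : ℝ) :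
    ((qPochInfReal a p : ℝ) : ℂ) = qPochInf a p := by
  have h := (Complex.continuous_ofReal.tendsto _).comp (tendsto_qProd_real hp0 hp1 a)
  refine tendsto_nhds_unique h ((tendsto_qProd hp0 hp1 a).congr fun n => ?_)
  exact (ofReal_qProd a p n).symm

lemma qPochInfReal_eq_mul {p : ℝ} (hp0 : 0 ≤ p) (hp1 : p < 1) (y : ℝ) (n : ℕ) :
    qPochInfReal y p = qProd y p n * qPochInfReal (y * p ^ n) p := by
  have h1 := (tendsto_add_atTop_iff_nat n).mpr (tendsto_qProd_real hp0 hp1 y)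
  have h2 := (tendsto_qProd_real hp0 hp1 (y * p ^ n)).const_mul (qProd y p n)
  refine tendsto_nhds_unique h1 (h2.congr fun k => ?_)
  rw [qProd, qProd, qProd, add_comm, Finset.prod_range_add]
  congr 1
  exact Finset.prod_congr rfl fun j _ => by ring

/-- The terms of Euler's series `∑ p ^ (n choose 2) y ^ n / (p; p)_n = (-y; p)_∞`. -/
def eulerTerm (p y : ℝ) (n : ℕ) : ℝ := p ^ (n.choose 2) * y ^ n / qProd p p n

section Euler

variable {p : ℝ} (hp0 : 0 < p) (hp1 : p < 1)
include hp0 hp1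

omit hp0 hp1 in
lemma ofReal_eulerTerm (p y : ℝ) (n : ℕ) :
    ((eulerTerm p y n : ℝ) : ℂ) = onePhiOneTerm 0 (-y) p n := by
  rw [eulerTerm, onePhiOneTerm]
  push_cast
  rw [ofReal_qProd, zero_mul, qProd_zero_left, neg_neg]
  ring

lemma summable_eulerTerm (y : ℝ) : Summable (eulerTerm p y) := by
  have := summable_onePhiOneTerm hp0 hp1 (A := 0) (w := -(y : ℂ)) (by simp)
  rw [← Complex.summable_ofReal]
  exact this.congr fun n => (ofReal_eulerTerm p y n).symm

lemma tsum_eulerTerm (y : ℝ) : ∑' n, eulerTerm p y n = qPochInfReal (-y) p := by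
  have := tsum_onePhiOneTerm hp0 hp1 (A := 0) (w := -(y : ℂ)) (by simp)
  rw [zero_mul, show qPochInf 0 p = 1 by simp [qPochInf], one_mul,
    ← tsum_congr (ofReal_eulerTerm p y), ← Complex.ofReal_tsum, ← Complex.ofReal_neg,
    ← ofReal_qPochInfReal hp0.le hp1] at this
  exact_mod_cast this

lemma qProd_self_pos (n : ℕ) : 0 < qProd p p n :=
  Finset.prod_pos fun j _ => by
    have := pow_lt_one₀ hp0.le hp1 (Nat.succ_ne_zero j)
    rw [pow_succ'] at this
    linarith

lemma eulerTerm_nonneg {y : ℝ} (hy : 0 ≤ y) (n : ℕ) : 0 ≤ eulerTerm p y n := by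
  have := qProd_self_pos hp0 hp1 n
  rw [eulerTerm]
  positivity

end Euler

lemma choose_two_two_mul (k : ℕ) : (2 * k).choose 2 = 2 * (k * (k - 1)) + k := by
  cases k with
  | zero => rfl
  | succ k =>
    induction k with
    | zero => rfl
    | succ k ih =>
      rw [show 2 * (k + 1 + 1) = 2 * (k + 1) + 1 + 1 by ring, Nat.choose_succ_succ' _ 1,
        Nat.choose_succ_succ' _ 1, ih, Nat.choose_one_right, Nat.choose_one_right,
        Nat.add_sub_cancel, Nat.add_sub_cancel]
      ring

lemma choose_two_two_mul_add_one (k : ℕ) :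
    (2 * k + 1).choose 2 = 2 * (k * (k - 1)) + 3 * k := by
  rw [Nat.choose_succ_succ' _ 1, Nat.choose_one_right, choose_two_two_mul]
  ring

/-- The argument `s / (a s ^ (2n))` at which Euler's series splits into the Hankel parts. -/
def hankelArg (a s : ℝ) (n : ℕ) : ℝ := s / (a * (s ^ 2) ^ n)

section Hankel

variable {a s : ℝ} (hs0 : 0 < s) (hs1 : s < 1) (ha0 : a ≠ 0)
include hs0 ha0

lemma zpow_two_sub (n : ℕ) : (s ^ 4) ^ (2 - (n : ℤ)) / a ^ 2 = s ^ 6 * hankelArg a s n ^ 2 := by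
  have h4 : s ^ 4 ≠ 0 := by positivity
  rw [hankelArg, zpow_sub₀ h4, zpow_natCast, zpow_ofNat, div_pow, mul_pow, ← pow_mul, ← pow_mul,
    ← pow_mul]
  field_simp
  ring

/-- The even part of Euler's series is a Hankel part. -/
lemma hankelPart_eq_even (n : ℕ) : hankelPart (a * s ^ 2) a (s ^ 4) n =
    ∑' k, eulerTerm (s ^ 2) (hankelArg a s n) (2 * k) := by
  have hz := zpow_two_sub hs0 ha0 n
  rw [hankelPart, zeroPhiOne]
  refine tsum_congr fun k => ?_
  have hb : s ^ 4 * a / (a * s ^ 2) = s ^ 2 := by field_simp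
  have hz' : (s ^ 4) ^ (2 - (n : ℤ)) / (a * s ^ 2) ^ 2 = s ^ 2 * hankelArg a s n ^ 2 := by
    rw [mul_pow, ← div_div, hz]; field_simp
  have hden : qPoch (s ^ 2) (s ^ 4) k * qPoch (s ^ 4) (s ^ 4) k =
      qProd (s ^ 2) (s ^ 2) (2 * k) := by
    rw [qProd_two_mul]
    change qProd _ _ _ * qProd _ _ _ = _
    ring_nf
  rw [hb, hz', hden, eulerTerm, choose_two_two_mul]
  congr 1
  rw [pow_add, pow_mul _ 2 (k * (k - 1)), pow_mul _ 2 k, mul_pow]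
  ring

include hs1

/-- The odd part of Euler's series is a multiple of the other Hankel part. -/
lemma hankelPart_eq_odd (n : ℕ) :
    hankelArg a s n / (1 - s ^ 2) * hankelPart a (a * s ^ 2) (s ^ 4) n =
      ∑' k, eulerTerm (s ^ 2) (hankelArg a s n) (2 * k + 1) := by
  have hz := zpow_two_sub hs0 ha0 n
  have h2 : 1 - s ^ 2 ≠ 0 := by nlinarith
  rw [hankelPart, zeroPhiOne, ← tsum_mul_left]
  refine tsum_congr fun k => ?_
  have hb : s ^ 4 * (a * s ^ 2) / a = s ^ 6 := by field_simp
  have hden : qProd (s ^ 2) (s ^ 2) (2 * k + 1) =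
      (1 - s ^ 2) * (qPoch (s ^ 6) (s ^ 4) k * qPoch (s ^ 4) (s ^ 4) k) := by
    rw [qProd_succ', qProd_two_mul]
    change _ = _ * (qProd _ _ _ * qProd _ _ _)
    ring_nf
  rw [hb, hz, eulerTerm, hden, choose_two_two_mul_add_one, ← mul_div_mul_comm]
  congr 1
  rw [pow_add, pow_mul _ 2 (k * (k - 1)), pow_succ _ (2 * k), pow_mul _ 2 k, mul_pow,
    pow_mul _ 3 k]
  ring

omit ha0 in
lemma summable_eulerTerm_even_odd (y : ℝ) :
    (Summable fun k => eulerTerm (s ^ 2) y (2 * k)) ∧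
      Summable fun k => eulerTerm (s ^ 2) y (2 * k + 1) := by
  have h := summable_eulerTerm (p := s ^ 2) (by positivity) (by nlinarith) y
  exact ⟨h.comp_injective fun i j hij => by simpa using hij,
    h.comp_injective fun i j hij => by simpa using hij⟩

omit hs1 in
lemma hankelArg_mul (n : ℕ) : hankelArg a s n * (s ^ 2) ^ n = s / a := by
  rw [hankelArg]; field_simp

lemma hankelPart_sub (n : ℕ) :
    hankelPart (a * s ^ 2) a (s ^ 4) n -
      hankelArg a s n / (1 - s ^ 2) * hankelPart a (a * s ^ 2) (s ^ 4) n =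
    qProd (hankelArg a s n) (s ^ 2) n * qPochInfReal (s / a) (s ^ 2) := by
  have hp0 : 0 < s ^ 2 := by positivity
  have hp1 : s ^ 2 < 1 := by nlinarith
  obtain ⟨h1, h2⟩ := summable_eulerTerm_even_odd hs0 hs1 (-hankelArg a s n)
  have e1 : ∀ k, eulerTerm (s ^ 2) (-hankelArg a s n) (2 * k) =
      eulerTerm (s ^ 2) (hankelArg a s n) (2 * k) := fun k => by
    rw [eulerTerm, eulerTerm, Even.neg_pow (even_two_mul k)]
  have e2 : ∀ k, eulerTerm (s ^ 2) (-hankelArg a s n) (2 * k + 1) =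
      -eulerTerm (s ^ 2) (hankelArg a s n) (2 * k + 1) := fun k => by
    rw [eulerTerm, eulerTerm, Odd.neg_pow (odd_two_mul_add_one k)]; ring
  have h := tsum_even_add_odd h1 h2
  rw [tsum_eulerTerm hp0 hp1, neg_neg, qPochInfReal_eq_mul hp0.le hp1 _ n, hankelArg_mul hs0 ha0,
    tsum_congr e1, tsum_congr e2, tsum_neg] at h
  rw [hankelPart_eq_even hs0 ha0, hankelPart_eq_odd hs0 hs1 ha0, sub_eq_add_neg, h]

omit hs1 in
lemma hankelArg_succ_mul (n : ℕ) : hankelArg a s (n + 1) * s ^ 2 = hankelArg a s n := by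
  rw [hankelArg, hankelArg, pow_succ]; field_simp

omit hs1 in
/-- Reversal of the finite product `(s / (a p ^ n); p)_n`, with `p = s²`. -/
lemma qProd_hankelArg (n : ℕ) :
    a ^ n * (s ^ 4) ^ (n.choose 2) * (s ^ 2) ^ n * ((-1) ^ n * qProd (hankelArg a s n) (s ^ 2) n) =
      gaussian s 0 n * qProd (a * s) (s ^ 2) n := by
  induction n with
  | zero => simp [gaussian]
  | succ n ih =>
    rw [qProd_succ', hankelArg_succ_mul hs0 ha0, gaussian_succ hs0.ne', qProd_succ,
      Nat.choose_succ_succ' n 1, Nat.choose_one_right, pow_zero, div_one]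
    have e4 : (s ^ 4) ^ n = ((s ^ 2) ^ n) ^ 2 := by rw [← pow_mul, ← pow_mul, ← pow_mul]; ring_nf
    have h1 : 1 - hankelArg a s (n + 1) = -(1 - a * s * (s ^ 2) ^ n) / (a * s * (s ^ 2) ^ n) := by
      rw [hankelArg, pow_succ]; field_simp; ring
    rw [h1, pow_add (s ^ 4), e4, pow_succ (s ^ 2) n, pow_succ a n, pow_succ (-1 : ℝ)]
    have hP : (s ^ 2) ^ n ≠ 0 := by positivity
    have hQ : (s ^ 2) ^ n * (1 - a * s * (s ^ 2) ^ n) * s / (s ^ 2) ^ n =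
      (1 - a * s * (s ^ 2) ^ n) * s := by field_simp
    calc _ = (a ^ n * (s ^ 4) ^ (n.choose 2) * (s ^ 2) ^ n *
          ((-1) ^ n * qProd (hankelArg a s n) (s ^ 2) n)) *
          (s * (s ^ 2) ^ n * (1 - a * s * (s ^ 2) ^ n)) := by
          rw [show n.choose (1 + 1) = n.choose 2 from rfl]
          field_simp
      _ = _ := by rw [ih]; ring

/-- Both Hankel parts are dominated by Euler's product at `-|s / (a p ^ n)|`. -/
lemma abs_hankelPart_le (n : ℕ) :
    |hankelPart (a * s ^ 2) a (s ^ 4) n| ≤ qPochInfReal (-|hankelArg a s n|) (s ^ 2) ∧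
    |hankelArg a s n / (1 - s ^ 2) * hankelPart a (a * s ^ 2) (s ^ 4) n| ≤
      qPochInfReal (-|hankelArg a s n|) (s ^ 2) := by
  have hp0 : 0 < s ^ 2 := by positivity
  have hp1 : s ^ 2 < 1 := by nlinarith
  obtain ⟨h1, h2⟩ := summable_eulerTerm_even_odd hs0 hs1 |hankelArg a s n|
  have habs : ∀ j, ‖eulerTerm (s ^ 2) (hankelArg a s n) j‖ =
      eulerTerm (s ^ 2) |hankelArg a s n| j := fun j => by
    rw [eulerTerm, eulerTerm, Real.norm_eq_abs, abs_div, abs_mul, abs_pow (hankelArg a s n),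
      abs_of_pos (qProd_self_pos hp0 hp1 j), abs_of_pos (by positivity)]
  have hnn := eulerTerm_nonneg hp0 hp1 (abs_nonneg (hankelArg a s n))
  have h := tsum_even_add_odd h1 h2
  rw [tsum_eulerTerm hp0 hp1] at h
  rw [hankelPart_eq_even hs0 ha0, hankelPart_eq_odd hs0 hs1 ha0, ← h]
  constructor
  · have : 0 ≤ ∑' k, eulerTerm (s ^ 2) |hankelArg a s n| (2 * k + 1) :=
      tsum_nonneg fun k => hnn (2 * k + 1)
    have h3 := norm_tsum_le_tsum_norm (f := fun k => eulerTerm (s ^ 2) (hankelArg a s n) (2 * k))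
      (by simpa only [habs] using h1)
    simp only [habs] at h3
    rw [Real.norm_eq_abs] at h3
    linarith
  · have : 0 ≤ ∑' k, eulerTerm (s ^ 2) |hankelArg a s n| (2 * k) :=
      tsum_nonneg fun k => hnn (2 * k)
    have h3 := norm_tsum_le_tsum_norm
      (f := fun k => eulerTerm (s ^ 2) (hankelArg a s n) (2 * k + 1))
      (by simpa only [habs] using h2)
    simp only [habs] at h3
    rw [Real.norm_eq_abs] at h3
    linarith

omit hs1 in
lemma abs_hankelArg_succ_mul (n : ℕ) : |hankelArg a s (n + 1)| * s ^ 2 = |hankelArg a s n| := by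
  rw [← hankelArg_succ_mul hs0 ha0 n, abs_mul, abs_of_pos (by positivity : 0 < s ^ 2)]

/-- Euler's product at `-|s / (a p ^ n)|` grows like half of the Gaussian factor in the weights. -/
lemma exists_qPochInfReal_le : ∃ c : ℝ, 0 ≤ c ∧ ∀ n,
    (s ^ 2) ^ (n.choose 2) * |qPochInfReal (-|hankelArg a s n|) (s ^ 2)| ≤
      c * ((1 + |s / a|) / s ^ 2) ^ n := by
  have hp0 : 0 < s ^ 2 := by positivity
  have hp1 : s ^ 2 < 1 := by nlinarith
  have hfin : ∀ n, (s ^ 2) ^ (n.choose 2) * |qProd (-|hankelArg a s n|) (s ^ 2) n| ≤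
      ((1 + |s / a|) / s ^ 2) ^ n := by
    intro n
    induction n with
    | zero => simp
    | succ n ih =>
      have hy := abs_nonneg (hankelArg a s (n + 1))
      rw [qProd_succ', neg_mul, abs_hankelArg_succ_mul hs0 ha0, Nat.choose_succ_succ' n 1,
        Nat.choose_one_right, pow_add, abs_mul, sub_neg_eq_add, pow_succ,
        abs_of_pos (by positivity : 0 < 1 + |hankelArg a s (n + 1)|)]
      have h1 : (s ^ 2) ^ n * (1 + |hankelArg a s (n + 1)|) ≤ (1 + |s / a|) / s ^ 2 := by
        rw [le_div_iff₀ hp0, mul_assoc, add_mul, abs_hankelArg_succ_mul hs0 ha0, mul_add,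
          ← hankelArg_mul hs0 ha0 n, abs_mul, abs_of_pos (pow_pos hp0 n), one_mul, ← pow_succ]
        have := pow_le_one₀ hp0.le hp1.le (n := n + 1)
        linarith
      calc _ = ((s ^ 2) ^ (n.choose 2) * |qProd (-|hankelArg a s n|) (s ^ 2) n|) *
            ((s ^ 2) ^ n * (1 + |hankelArg a s (n + 1)|)) := by
            rw [show n.choose (1 + 1) = n.choose 2 from rfl]; ring_nf
        _ ≤ _ := mul_le_mul ih h1 (by positivity) (by positivity)
  refine ⟨|qPochInfReal (-|s / a|) (s ^ 2)|, abs_nonneg _, fun n => ?_⟩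
  rw [qPochInfReal_eq_mul hp0.le hp1 _ n, neg_mul,
    show |hankelArg a s n| * (s ^ 2) ^ n = |s / a| by
      rw [← hankelArg_mul hs0 ha0 n, abs_mul, abs_of_pos (pow_pos hp0 n)],
    abs_mul, ← mul_assoc, mul_comm]
  exact mul_le_mul_of_nonneg_left (hfin n) (abs_nonneg _)

lemma summable_mul_hankelPart {u : ℕ → ℝ} {K : ℝ} (hK : 0 < K) (hu : ∀ n, |u n| ≤ K ^ n) (b : ℝ) :
    (Summable fun n => b ^ n * (s ^ 4) ^ (n.choose 2) *
      hankelPart (a * s ^ 2) a (s ^ 4) n * u n) ∧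
    Summable fun n => b ^ n * (s ^ 4) ^ (n.choose 2) *
      hankelPart a (a * s ^ 2) (s ^ 4) n * u n := by
  have hp0 : 0 < s ^ 2 := by positivity
  have hp1 : s ^ 2 < 1 := by nlinarith
  obtain ⟨c, hc, hE⟩ := exists_qPochInfReal_le hs0 hs1 ha0
  -- a bound by Euler's product suffices
  have key : ∀ (h : ℕ → ℝ) (M : ℝ), 0 ≤ M →
      (∀ n, |h n| ≤ M * |qPochInfReal (-|hankelArg a s n|) (s ^ 2)|) →
      Summable fun n => b ^ n * (s ^ 4) ^ (n.choose 2) * h n * u n := by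
    intro h M hM hh
    refine Summable.of_norm_bounded ((summable_pow_choose_mul_pow hp0 hp1
      (|b| * ((1 + |s / a|) / s ^ 2) * K)).mul_left (M * c)) fun n => ?_
    have e4 : (s ^ 4) ^ (n.choose 2) = (s ^ 2) ^ (n.choose 2) * (s ^ 2) ^ (n.choose 2) := by
      rw [← mul_pow]; ring_nf
    rw [Real.norm_eq_abs, abs_mul, abs_mul, abs_mul, abs_pow, e4,
      abs_of_pos (by positivity : 0 < (s ^ 2) ^ (n.choose 2) * (s ^ 2) ^ (n.choose 2))]
    calc _ ≤ |b| ^ n * ((s ^ 2) ^ (n.choose 2) * (s ^ 2) ^ (n.choose 2)) *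
          (M * |qPochInfReal (-|hankelArg a s n|) (s ^ 2)|) * K ^ n := by
          gcongr
          · exact hh n
          · exact hu n
      _ = |b| ^ n * (s ^ 2) ^ (n.choose 2) * M * K ^ n * ((s ^ 2) ^ (n.choose 2) *
          |qPochInfReal (-|hankelArg a s n|) (s ^ 2)|) := by ring
      _ ≤ |b| ^ n * (s ^ 2) ^ (n.choose 2) * M * K ^ n *
          (c * ((1 + |s / a|) / s ^ 2) ^ n) :=
          mul_le_mul_of_nonneg_left (hE n) (by positivity)
      _ = _ := by
          generalize (1 + |s / a|) / s ^ 2 = X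
          ring
  refine ⟨key _ 1 zero_le_one fun n => ?_, key _ (|a / s| * (1 - s ^ 2)) ?_ fun n => ?_⟩
  · rw [one_mul]
    exact (abs_hankelPart_le hs0 hs1 ha0 n).1.trans (le_abs_self _)
  · exact mul_nonneg (abs_nonneg _) (by linarith)
  · have h1 := ((abs_hankelPart_le hs0 hs1 ha0 n).2).trans (le_abs_self _)
    have h2 : 1 - s ^ 2 ≠ 0 := by linarith
    have h3 : hankelPart a (a * s ^ 2) (s ^ 4) n = a / s * (1 - s ^ 2) * (s ^ 2) ^ n *
        (hankelArg a s n / (1 - s ^ 2) * hankelPart a (a * s ^ 2) (s ^ 4) n) := by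
      rw [hankelArg]; field_simp
    rw [h3, abs_mul, abs_mul, abs_mul, abs_of_pos (by linarith : 0 < 1 - s ^ 2),
      abs_of_pos (pow_pos hp0 n)]
    refine mul_le_mul ?_ h1 (abs_nonneg _) ?_
    · exact mul_le_of_le_one_right (mul_nonneg (abs_nonneg _) (by linarith))
        (pow_le_one₀ hp0.le hp1.le)
    · exact mul_nonneg (abs_nonneg _) (by linarith)

/-- The first row of `G` is a linear combination of the first rows of the two matrices `H`. -/
lemma gEntry_zero_eq (h0 : qPochInfReal (s / a) (s ^ 2) ≠ 0) (n : ℕ) :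
    gEntry a s 0 n =
      -(s / (a * (1 - s ^ 2) * qPochInfReal (s / a) (s ^ 2))) *
        ((-a) ^ n * (s ^ 4) ^ (n.choose 2) * hankelPart a (a * s ^ 2) (s ^ 4) n) +
      1 / qPochInfReal (s / a) (s ^ 2) *
        ((-(a * s ^ 2)) ^ n * (s ^ 4) ^ (n.choose 2) * hankelPart (a * s ^ 2) a (s ^ 4) n) := by
  have h := hankelPart_sub hs0 hs1 ha0 n
  have h2 : 1 - s ^ 2 ≠ 0 := by nlinarith
  have hy := hankelArg_mul hs0 ha0 n
  have hy' : s / (a * (1 - s ^ 2) * qPochInfReal (s / a) (s ^ 2)) =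
      hankelArg a s n * (s ^ 2) ^ n / ((1 - s ^ 2) * qPochInfReal (s / a) (s ^ 2)) := by
    rw [hy]; field_simp
  have hq : qProd (hankelArg a s n) (s ^ 2) n = (hankelPart (a * s ^ 2) a (s ^ 4) n -
      hankelArg a s n / (1 - s ^ 2) * hankelPart a (a * s ^ 2) (s ^ 4) n) /
        qPochInfReal (s / a) (s ^ 2) := by
    rw [h]; field_simp
  rw [gEntry, zero_add, ← qProd_hankelArg hs0 ha0, hq, hy', neg_pow a, neg_pow (a * s ^ 2),
    mul_pow a]
  field_simp
  ring

end Hankel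

/-! ### The matrices and polynomials in terms of `s = q ^ (1/4)` -/

lemma alSalamChihara_eq_asc (a b q x : ℝ) (n : ℕ) : alSalamChihara a b q x n = asc a b q x n := by
  induction n using Nat.twoStepInduction with
  | zero => rfl
  | one => rfl
  | more n h1 h2 => rw [alSalamChihara, asc, h1, h2]

lemma ofReal_asc (a b q x : ℝ) (n : ℕ) :
    ((asc a b q x n : ℝ) : ℂ) = asc (a : ℂ) b q x n := by
  induction n using Nat.twoStepInduction with
  | zero => simp [asc]
  | one => simp [asc]
  | more n h1 h2 => rw [asc, asc, ← h1, ← h2]; push_cast; ring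

lemma matH_zero_mul_phi (a b q y : ℝ) (n : ℕ) :
    matH a b q 0 n * phi a b q n y =
      (-a) ^ n * q ^ (n.choose 2) * hankelPart a b q n *
        (asc a b q (y / 2) n / normFactor a b q n ^ 2) := by
  have h0 : weight a b q 0 = 1 := by simp [weight, normFactor, qPoch]
  rw [matH, h0, weight, phi, Nat.choose_two_right, zero_add, alSalamChihara_eq_asc]
  ring

section

variable {a s : ℝ} (hs0 : 0 < s) (hs1 : s < 1)
include hs0

lemma rpow_quarter : (s ^ 4) ^ (1 / 4 : ℝ) = s := by
  rw [← Real.rpow_natCast, ← Real.rpow_mul hs0.le]; norm_num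

lemma rpow_half : (s ^ 4) ^ (1 / 2 : ℝ) = s ^ 2 := by
  rw [← Real.rpow_natCast, ← Real.rpow_mul hs0.le, ← Real.rpow_natCast]; norm_num

lemma rpow_gaussian (m n : ℕ) : (s ^ 4) ^ (((m : ℝ) - (n : ℝ)) ^ 2 / 4) = gaussian s m n := by
  rw [gaussian, ← Real.rpow_natCast s 4, ← Real.rpow_mul hs0.le,
    ← Real.rpow_natCast s (m ^ 2 + n ^ 2), ← Real.rpow_natCast s (2 * m * n), ← Real.rpow_sub hs0]
  congr 1
  push_cast
  ring

lemma matG_eq (m n : ℕ) :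
    matG a (s ^ 4) m n = gEntry a s m n / √(ascDen a s m * ascDen a s n) := by
  rw [matG, rpow_gaussian hs0, rpow_quarter hs0, rpow_half hs0]
  rfl

variable (ha : |a * s| < 1)
include hs1 ha

lemma ascDen_pos (n : ℕ) : 0 < ascDen a s n := by
  have h := abs_sq_mul_sq_lt_one ha
  refine mul_pos (qProd_self_pos (by positivity) (pow_lt_one₀ hs0.le hs1 (by norm_num)) n)
    (Finset.prod_pos fun j _ => ?_)
  have h1 : (s ^ 4) ^ j ≤ 1 := pow_le_one₀ (by positivity) (pow_le_one₀ hs0.le hs1.le)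
  have h2 := mul_le_of_le_one_right (by positivity : 0 ≤ a ^ 2 * s ^ 2) h1
  have h3 := le_abs_self (a ^ 2 * s ^ 2)
  linarith

omit hs0 hs1 ha in
lemma phi_eq (a s x : ℝ) (n : ℕ) : phi a (a * s ^ 2) (s ^ 4) n (2 * x) =
    asc a (a * s ^ 2) (s ^ 4) x n / √(ascDen a s n) := by
  rw [phi, alSalamChihara_eq_asc, mul_div_cancel_left₀ x two_ne_zero, normFactor, ascDen]
  rw [show a * (a * s ^ 2) = a ^ 2 * s ^ 2 by ring]
  rfl

lemma matG_mul_phi (x : ℝ) (m n : ℕ) :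
    matG a (s ^ 4) m n * phi a (a * s ^ 2) (s ^ 4) n (2 * x) =
      gEntry a s m n * dualPoly a s x n / √(ascDen a s m) := by
  have hm := ascDen_pos hs0 hs1 ha m
  have hn := ascDen_pos hs0 hs1 ha n
  rw [matG_eq hs0, phi_eq, dualPoly, Real.sqrt_mul hm.le]
  have h1 := Real.sqrt_ne_zero'.mpr hm
  have h2 := Real.sqrt_ne_zero'.mpr hn
  rw [← Real.sq_sqrt hn.le, Real.sqrt_sq (Real.sqrt_nonneg _)]
  field_simp

lemma matG_zero_mul_phi (x : ℝ) (n : ℕ) :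
    matG a (s ^ 4) 0 n * phi a (a * s ^ 2) (s ^ 4) n (2 * x) =
      gEntry a s 0 n * dualPoly a s x n := by
  rw [matG_mul_phi hs0 hs1 ha]
  simp [ascDen]

lemma funG_eq (x : ℝ) : funG a (s ^ 4) x = ∑' n, gEntry a s 0 n * dualPoly a s x n := by
  rw [funG, rpow_half hs0]
  exact tsum_congr (matG_zero_mul_phi hs0 hs1 ha x)

lemma ofReal_gEntry_mul_dualPoly (x : ℝ) (n : ℕ) :
    ((gEntry a s 0 n * dualPoly a s x n : ℝ) : ℂ) = gTerm s x a n := by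
  have hden : ascDen a s n = qProd (s ^ 4) (s ^ 4) n *
      (qProd (a * s) (s ^ 2) n * qProd (-(a * s)) (s ^ 2) n) := by
    rw [ascDen, ← qProd_sq]; ring_nf
  have h0 : qProd (a * s) (s ^ 2) n ≠ 0 :=
    qProd_ne_zero ha (by
      rw [Real.norm_eq_abs, abs_of_pos (by positivity)]; exact pow_le_one₀ hs0.le hs1.le) n
  have h : gEntry a s 0 n * dualPoly a s x n = (s ^ 2) ^ (n.choose 2) * s ^ n *
      asc a (a * s ^ 2) (s ^ 4) x n /
        (qProd (s ^ 4) (s ^ 4) n * qProd (-(a * s)) (s ^ 2) n) := by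
    rw [gEntry, dualPoly, gaussian_eq hs0, hden, zero_add]
    simp only [zero_pow two_ne_zero, mul_zero, pow_zero, div_one, one_mul]
    generalize qProd (a * s) (s ^ 2) n = R at *
    field_simp
  rw [h, gTerm]
  push_cast
  rw [ofReal_qProd, ofReal_qProd, ofReal_asc]
  push_cast
  rfl

end

end QHankel

end

theorem mainTheorem8 (q a : ℝ) (hq0 : 0 < q) (hq1 : q < 1) (ha0 : a ≠ 0)
    (ha : |a| < q ^ (-(1 / 4) : ℝ)) (θ : ℝ) (hθ : θ ∈ Set.Ioo 0 Real.pi) :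
    Summable (fun n : ℕ =>
      QHankel.matG a q 0 n * QHankel.phi a (a * q ^ (1 / 2 : ℝ)) q n (2 * Real.cos θ)) ∧
    (QHankel.funG a q (Real.cos θ) : ℂ) =
      QHankel.qPochInf ((q ^ (1 / 2 : ℝ) : ℝ) : ℂ) q *
        (QHankel.qPochInf (-((q ^ (1 / 4 : ℝ) : ℝ) : ℂ) * Complex.exp (Complex.I * (θ : ℂ)))
            (q ^ (1 / 2 : ℝ)) *
          QHankel.qPochInf (-((q ^ (1 / 4 : ℝ) : ℝ) : ℂ) * Complex.exp (-(Complex.I * (θ : ℂ))))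
            (q ^ (1 / 2 : ℝ))) /
        QHankel.qPochInf ((-(a * q ^ (1 / 4 : ℝ)) : ℝ) : ℂ) (q ^ (1 / 2 : ℝ)) ∧
    (∀ m : ℕ, HasSum (fun n : ℕ =>
      QHankel.matG a q m n * QHankel.phi a (a * q ^ (1 / 2 : ℝ)) q n (2 * Real.cos θ))
      (QHankel.funG a q (Real.cos θ) *
        QHankel.phi a (a * q ^ (1 / 2 : ℝ)) q m (2 * Real.cos θ))) ∧
    ((∀ k : ℕ, a ≠ q ^ (1 / 4 + (k : ℝ) / 2)) →
      Summable (fun n : ℕ => QHankel.matH a (a * q ^ (1 / 2 : ℝ)) q 0 n *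
        QHankel.phi a (a * q ^ (1 / 2 : ℝ)) q n (2 * Real.cos θ)) ∧
      Summable (fun n : ℕ => QHankel.matH (a * q ^ (1 / 2 : ℝ)) a q 0 n *
        QHankel.phi (a * q ^ (1 / 2 : ℝ)) a q n (2 * Real.cos θ)) ∧
      QHankel.funG a q (Real.cos θ) =
        QHankel.coeffA a q * QHankel.funH a (a * q ^ (1 / 2 : ℝ)) q (Real.cos θ) +
        QHankel.coeffB a q * QHankel.funH (a * q ^ (1 / 2 : ℝ)) a q (Real.cos θ)) := by
  obtain ⟨s, hs0, rfl⟩ : ∃ s : ℝ, 0 < s ∧ q = s ^ 4 :=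
    ⟨q ^ (1 / 4 : ℝ), by positivity, by
      rw [← Real.rpow_natCast, ← Real.rpow_mul hq0.le]; norm_num⟩
  have hs1 : s < 1 := (pow_lt_one_iff_of_nonneg hs0.le (by norm_num)).mp hq1
  have has : |a * s| < 1 := by
    rw [Real.rpow_neg hq0.le, QHankel.rpow_quarter hs0] at ha
    have h := mul_lt_mul_of_pos_right ha hs0
    rwa [inv_mul_cancel₀ hs0.ne', ← abs_of_pos hs0, ← abs_mul] at h
  have hx : |Real.cos θ| ≤ 1 := Real.abs_cos_le_one θ
  have hp0 : 0 < s ^ 2 := by positivity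
  have hp1 : s ^ 2 < 1 := by nlinarith
  simp only [QHankel.coeffA, QHankel.coeffB, QHankel.funH]
  rw [QHankel.rpow_half hs0, QHankel.rpow_quarter hs0, QHankel.funG_eq hs0 hs1 has]
  have hS := QHankel.summable_gEntry_mul hs0 hs1 has hx
  refine ⟨?_, ?_, fun m => ?_, fun hne => ?_⟩
  · simpa only [QHankel.matG_zero_mul_phi hs0 hs1 has] using hS 0
  · rw [Complex.ofReal_tsum, tsum_congr (QHankel.ofReal_gEntry_mul_dualPoly hs0 hs1 has _)]
    have hz : ‖Complex.exp (Complex.I * θ)‖ = 1 := by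
      rw [mul_comm]; exact Complex.norm_exp_ofReal_mul_I θ
    rw [QHankel.tsum_gTerm hs0 hs1 (z := Complex.exp (Complex.I * θ)) ?_ ?_ hz ?_,
      ← Complex.exp_neg]
    · push_cast
      rfl
    · rw [Complex.norm_real]; exact hx
    · rw [← Complex.ofReal_mul, Complex.norm_real]; exact has
    · rw [Complex.ofReal_cos, Complex.cos, mul_div_cancel₀ _ two_ne_zero, mul_comm Complex.I]
      rw [add_mul, ← Complex.exp_add, ← Complex.exp_add, sq, ← Complex.exp_add]
      simp
  · simp only [QHankel.matG_mul_phi hs0 hs1 has]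
    rw [QHankel.phi_eq, ← mul_div_assoc, ← QHankel.tsum_gEntry_eq hs0 hs1 has hx m]
    exact (hS m).hasSum.div_const _
  · -- the excluded values of `a` are those for which `A` and `B` have a vanishing denominator
    have hE : QHankel.qPochInfReal (s / a) (s ^ 2) ≠ 0 := by
      rw [← Complex.ofReal_ne_zero, QHankel.ofReal_qPochInfReal hp0.le hp1]
      refine QHankel.qPochInf_ne_zero hp0.le hp1 fun k hk => hne k ?_
      have hk' : 1 - s / a * (s ^ 2) ^ k = 0 := by exact_mod_cast hk
      rw [Real.rpow_add hq0, QHankel.rpow_quarter hs0,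
        show (k : ℝ) / 2 = 1 / 2 * k by ring, Real.rpow_mul hq0.le, QHankel.rpow_half hs0,
        Real.rpow_natCast]
      field_simp at hk'
      linarith
    obtain ⟨K, hK0, hK⟩ := QHankel.exists_abs_dualPoly_le hs0 hs1 has
    have hn : ∀ n, QHankel.normFactor a (a * s ^ 2) (s ^ 4) n ^ 2 = QHankel.ascDen a s n := by
      intro n
      have h := (QHankel.ascDen_pos hs0 hs1 has n).le
      rw [QHankel.ascDen, ← show a * (a * s ^ 2) = a ^ 2 * s ^ 2 by ring] at h ⊢
      exact Real.sq_sqrt h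
    have hn' : ∀ n, QHankel.normFactor (a * s ^ 2) a (s ^ 4) n ^ 2 = QHankel.ascDen a s n := by
      intro n
      rw [← hn, QHankel.normFactor, QHankel.normFactor, mul_comm (a * s ^ 2)]
    have hd : ∀ n, QHankel.asc a (a * s ^ 2) (s ^ 4) (Real.cos θ) n / QHankel.ascDen a s n =
        QHankel.dualPoly a s (Real.cos θ) n := fun _ => rfl
    simp only [QHankel.matH_zero_mul_phi, hn, hn', QHankel.asc_comm (a * s ^ 2) a,
      mul_div_cancel_left₀ _ (two_ne_zero' ℝ), hd]
    have h1 := (QHankel.summable_mul_hankelPart hs0 hs1 ha0 hK0 (hK _ hx) (-a)).2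
    have h2 := (QHankel.summable_mul_hankelPart hs0 hs1 ha0 hK0 (hK _ hx) (-(a * s ^ 2))).1
    refine ⟨h1, h2, ?_⟩
    -- the identity holds term by term
    rw [← tsum_mul_left, ← tsum_mul_left, ← (h1.mul_left _).tsum_add (h2.mul_left _)]
    refine tsum_congr fun n => ?_
    rw [QHankel.gEntry_zero_eq hs0 hs1 ha0 hE]
    ring
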